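/- **Setting.** Let $J=\begin{pmatrix}0&1\\-1&0\end{pmatrix}$, $\mu^-<\mu^+$ and $\Lambda=(\mu^-,\mu^+)$. Let $P$ be a continuous map from $(0,+\infty)$ to the real symmetric $2\times2$ matrices such that - $P(x)\to P_\infty:=\operatorname{diag}(\mu^-,\mu^+)$ as $x\to+\infty$, and $\int_1^{+\infty}\|P(x)-P_\infty\|^{q_\infty}\,dx<+\infty$ for some $q_\infty\ge1$; - for some $\beta\ge 1$, some symmetric matrix $P^*$ and some $q_0\ge1$, $x^\beta P(x)\to P^*$ as $x\to0^+$ and $\int_0^1x^{-\beta}\|x^\beta P(x)-P^*\|^{q_0}\,dx<+\infty$; - $\det P^*<-1/4$ if $\beta=1$, and $\det P^*<0$ if $\beta>1$. Let $S$ be a continuous map from $(0,+\infty)\times\mathbb R^2$ to the real symmetric $2\times 2$ matrices such that - there are $\alpha\in L^\infty(0,+\infty)$ and $\eta_{ij}\in C(\mathbb R^2)$ with $\eta_{ij}(0)=0$ and $|S_{ij}(x,z)|\le\alpha(x)\eta_{ij}(z)$ for all $x>0$, $z\in\mathbb R^2$, $i,j\in\{1,2\}$; - for every compact $K\subset\mathbb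 R^2$ there is $A_K>0$ with $\|S(x,z)-S(x,z')\|\le A_K\|z-z'\|$ for all $x>0$, $z,z'\in K$. Put $\tau z=Jz'+P(x)z$ and let $A_0z=\tau z$ be the operator in $L^2(0,+\infty)$ with domain $D_0=\{z\in L^2(0,+\infty): z\in AC_{\rm loc}(0,+\infty),\ \tau z\in L^2(0,+\infty)\}$. Let $\Sigma$ be the set of $(w,\lambda)\in D_0\times\Lambda$ with $w\ne0$ and $Jw'+P(x)w=\lambda w+S(x,w)w$ a.e. on $(0,+\infty)$, and let $$\Sigma'=\Sigma\cup\{(0,\lambda):\lambda\in\Lambda\text{ is an eigenvalue of }A_0\}.$$ For $z:(0,+\infty)\to\mathbb R^2$ with $z=(\rho\cos\theta,\rho\sin\theta)$, $\rho>0$, $\theta$ continuous, set $$\operatorname{rot}(z)=\frac{\lim_{x\to+\infty}\theta(x)-\lim_{x\to0^+}\theta(x)}{\pi}$$ whenever both limits exist and are finite. For $(w,\lambda)\in\Sigma'$ let $j(w,\lambda)=\operatorname{rot}(w)$ if $w\neq0$, and $j(0,\lambda)=\operatorname{rot}(z_\lambda)$, where $z_\lambda\in H^1(0,+\infty)$ is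 any nontrivial solution of $Jz'+P(x)z=\lambda z$. Let $w_1^*$ be an eigenvector of $J^{-1}P^*$ for its negative eigenvalue $-\sqrt{-\det P^*}$. Define $i(w,\lambda)=\lfloor j(w,\lambda)\rfloor$ if $w_1^*$ has an angle in $(0,\pi/2)$ modulo $\pi$, and $i(w,\lambda)=\lfloor j(w,\lambda)+\tfrac12\rfloor$ if it has an angle in $(\pi/2,\pi)$ modulo $\pi$. **Proposition.** Every $(w,\lambda)\in\Sigma'$ satisfies $w\in H^1_0(0,+\infty)$, and $j$ is well defined on $\Sigma'$ (the limits exist, and the value does not depend on the choice of $\theta$ or of $z_\lambda$). The functional $j:\Sigma'\to\mathbb R$ is continuous for the topology induced by $H^1_0(0,+\infty)\times\mathbb R$. If $w_1^*$ is not parallel to a coordinate axis (so that $i$ is defined), then $i:\Sigma'\to\mathbb Z$ is continuous for the same topology. -/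

import Mathlib

open MeasureTheory Set Filter Topology
open scoped Matrix Matrix.Norms.L2Operator

namespace DiracBif

/-- The phase plane, with its Euclidean norm. -/
abbrev Plane : Type := EuclideanSpace ℝ (Fin 2)

/-- Real `2 × 2` matrices; norms of matrices are operator norms on the Euclidean plane. -/
abbrev Mat : Type := Matrix (Fin 2) (Fin 2) ℝ

/-- The action `A v` of a matrix on a vector of the plane. -/
noncomputable def act (A : Mat) (v : Plane) : Plane := Matrix.toEuclideanLin A v

/-- The symplectic matrix `J`. -/
def J : Mat := !![0, 1; -1, 0]

/-- Lebesgue measure on the half-line `(0, +∞)`. -/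
noncomputable def halfLine : Measure ℝ := volume.restrict (Ioi 0)

/-- Local absolute continuity on the open half-line `(0, +∞)`. -/
def LocAC (z : ℝ → Plane) : Prop :=
  ∀ a b : ℝ, 0 < a → a < b → AbsolutelyContinuousOnInterval z a b

/-- A function on `(0, +∞)` is represented by its extension by zero to `ℝ`. -/
def OnHalfLine (z : ℝ → Plane) : Prop := ∀ x ≤ 0, z x = 0

/-! ### The coefficient classes -/

/-- The limit `diag (μ⁻, μ⁺)` of the coefficient matrix at infinity. -/
def Pinf (μm μp : ℝ) : Mat := !![μm, 0; 0, μp]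

/-- The class of admissible continuous symmetric coefficients `P` on `(0, +∞)`,
with the order `β` of the singularity at zero and the limit matrix `Pstar = lim x ^ β P(x)`. -/
structure ClassP (μm μp : ℝ) (P : ℝ → Mat) (β : ℝ) (Pstar : Mat) : Prop where
  continuousOn : ContinuousOn P (Ioi 0)
  symm : ∀ x > 0, (P x).IsSymm
  tendsto_atTop : Tendsto P atTop (𝓝 (Pinf μm μp))
  integrable_atTop : ∃ q : ℝ, 1 ≤ q ∧
    IntegrableOn (fun x => ‖P x - Pinf μm μp‖ ^ q) (Ioi 1)
  one_le_beta : 1 ≤ β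
  symm_star : Pstar.IsSymm
  tendsto_zero : Tendsto (fun x => x ^ β • P x) (𝓝[>] 0) (𝓝 Pstar)
  integrable_zero : ∃ q : ℝ, 1 ≤ q ∧
    IntegrableOn (fun x => 1 / x ^ β * ‖x ^ β • P x - Pstar‖ ^ q) (Ioo 0 1)
  det_of_eq_one : β = 1 → Pstar.det < -1 / 4
  det_of_one_lt : 1 < β → Pstar.det < 0

/-- The class of admissible nonlinearities `S : (0, +∞) × ℝ² → M²_S`. -/
structure ClassS (S : ℝ → Plane → Mat) : Prop where
  continuousOn : ContinuousOn (fun p : ℝ × Plane => S p.1 p.2) (Ioi 0 ×ˢ univ)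
  symm : ∀ x > 0, ∀ z, (S x z).IsSymm
  bound : ∃ (α : ℝ → ℝ) (η : Fin 2 → Fin 2 → Plane → ℝ), MemLp α ⊤ halfLine ∧
    (∀ i j, Continuous (η i j) ∧ η i j 0 = 0) ∧
    ∀ x > 0, ∀ z i j, |S x z i j| ≤ α x * η i j z
  lipschitz : ∀ K : Set Plane, IsCompact K → ∃ A > 0, ∀ x > 0, ∀ z ∈ K, ∀ z' ∈ K,
    ‖S x z - S x z'‖ ≤ A * ‖z - z'‖

/-! ### The operator and the solution sets -/

/-- The differential expression `τ z = J z' + P z`. -/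
noncomputable def tau (P : ℝ → Mat) (z : ℝ → Plane) (x : ℝ) : Plane :=
  act J (deriv z x) + act (P x) (z x)

/-- The domain `D₀` of the self-adjoint realization `A₀` of `τ` in `L²(0, +∞)`. -/
def D0 (P : ℝ → Mat) : Set (ℝ → Plane) :=
  {z | OnHalfLine z ∧ LocAC z ∧ MemLp z 2 halfLine ∧ MemLp (tau P z) 2 halfLine}

/-- The real number `lam` is an eigenvalue of `A₀`. -/
def IsEigenvalueA0 (P : ℝ → Mat) (lam : ℝ) : Prop :=
  ∃ z ∈ D0 P, z ≠ 0 ∧ ∀ᵐ x ∂halfLine, tau P z x = lam • z x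

/-- The set `Σ` of nontrivial solutions `(w, lam) ∈ D₀ × (μ⁻, μ⁺)` of
`J w' + P(x) w = lam w + S(x, w) w`. -/
def Sig (μm μp : ℝ) (P : ℝ → Mat) (S : ℝ → Plane → Mat) : Set ((ℝ → Plane) × ℝ) :=
  {p | p.1 ∈ D0 P ∧ p.2 ∈ Ioo μm μp ∧ p.1 ≠ 0 ∧
    ∀ᵐ x ∂halfLine, tau P p.1 x = p.2 • p.1 x + act (S x (p.1 x)) (p.1 x)}

/-- The set `Σ'`: the nontrivial solutions together with the points `(0, lam)`,
`lam ∈ (μ⁻, μ⁺)` an eigenvalue of `A₀`. -/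
def Sig' (μm μp : ℝ) (P : ℝ → Mat) (S : ℝ → Plane → Mat) : Set ((ℝ → Plane) × ℝ) :=
  Sig μm μp P S ∪ {p | p.1 = 0 ∧ p.2 ∈ Ioo μm μp ∧ IsEigenvalueA0 P p.2}

/-! ### The spaces `H¹(0, +∞)` and `H¹₀(0, +∞)` -/

/-- `H¹(0, +∞)`, every class being represented by its locally absolutely continuous member,
whose almost everywhere derivative is the weak derivative. -/
def IsH1 (z : ℝ → Plane) : Prop :=
  OnHalfLine z ∧ LocAC z ∧ MemLp z 2 halfLine ∧ MemLp (deriv z) 2 halfLine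

/-- `H¹₀(0, +∞)`: the members of `H¹(0, +∞)` that vanish at `0`. -/
def IsH10 (z : ℝ → Plane) : Prop := IsH1 z ∧ Tendsto z (𝓝[>] 0) (𝓝 0)

theorem LocAC.ae_differentiableAt {z : ℝ → Plane} (hz : LocAC z) :
    ∀ᵐ x ∂halfLine, DifferentiableAt ℝ z x := by
  have h : ∀ n : ℕ, ∀ᵐ x, x ∈ uIcc (1 / ((n : ℝ) + 1)) ((n : ℝ) + 2) →
      DifferentiableAt ℝ z x := fun n => by
    refine (hz _ _ (by positivity) ?_).boundedVariationOn.ae_differentiableAt_of_mem_uIcc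
    have : 1 / ((n : ℝ) + 1) ≤ 1 := by
      rw [div_le_one (by positivity)]; linarith [(Nat.cast_nonneg n : (0 : ℝ) ≤ n)]
    linarith [(Nat.cast_nonneg n : (0 : ℝ) ≤ n)]
  unfold halfLine
  rw [ae_restrict_iff' measurableSet_Ioi]
  filter_upwards [ae_all_iff.2 h] with x hx hx0
  obtain ⟨n, hn⟩ := exists_nat_one_div_lt (show (0 : ℝ) < x from hx0)
  obtain ⟨m, hm⟩ := exists_nat_gt x
  refine hx (max n m) (Icc_subset_uIcc ⟨?_, ?_⟩)
  · refine le_trans ?_ hn.le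
    gcongr
    exact le_max_left _ _
  · have : (m : ℝ) ≤ ((max n m : ℕ) : ℝ) := by exact_mod_cast le_max_right _ _
    linarith

/-- `H¹₀(0, +∞)` as a vector space of functions. -/
def h10Submodule : Submodule ℝ (ℝ → Plane) where
  carrier := {z | IsH10 z}
  zero_mem' := by
    refine ⟨⟨fun _ _ => rfl, fun a b _ _ => ?_, MemLp.zero, ?_⟩, tendsto_const_nhds⟩
    · simp [absolutelyContinuousOnInterval_iff]
      exact fun ε hε => ⟨1, one_pos, fun _ _ _ _ => hε⟩
    · have h : deriv (0 : ℝ → Plane) = 0 := funext fun x => deriv_const x 0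
      change MemLp (deriv (0 : ℝ → Plane)) 2 halfLine
      rw [h]
      exact MemLp.zero
  add_mem' := by
    rintro z w ⟨⟨h1, h2, h3, h4⟩, h5⟩ ⟨⟨k1, k2, k3, k4⟩, k5⟩
    refine ⟨⟨fun x hx => by simp [h1 x hx, k1 x hx],
      fun a b ha hb => (h2 a b ha hb).add (k2 a b ha hb), h3.add k3, ?_⟩, ?_⟩
    · refine (memLp_congr_ae ?_).2 (h4.add k4)
      filter_upwards [h2.ae_differentiableAt, k2.ae_differentiableAt] with x hx kx
      exact deriv_add hx kx
    · simpa using! h5.add k5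
  smul_mem' := by
    rintro c z ⟨⟨h1, h2, h3, h4⟩, h5⟩
    refine ⟨⟨fun x hx => by simp [h1 x hx],
      fun a b ha hb => (h2 a b ha hb).const_smul c, h3.const_smul c, ?_⟩, ?_⟩
    · refine (memLp_congr_ae ?_).2 (h4.const_smul c)
      filter_upwards [h2.ae_differentiableAt] with x hx
      exact deriv_const_smul c hx
    · simpa using! h5.const_smul c

/-- The space `H¹₀(0, +∞)`; it carries the `H¹` norm, not the topology of pointwise convergence. -/
def H10 : Type := h10Submodule

noncomputable instance : AddCommGroup H10 := inferInstanceAs (AddCommGroup h10Submodule)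

/-- The underlying function of an element of `H¹₀(0, +∞)`. -/
def H10.fn (w : H10) : ℝ → Plane := w.1

theorem H10.isH10 (w : H10) : IsH10 w.fn := w.2

theorem H10.fn_add (z w : H10) : (z + w).fn = z.fn + w.fn := rfl

theorem H10.locAC (w : H10) : LocAC w.fn := w.isH10.1.2.1

theorem H10.memLp (w : H10) : MemLp w.fn 2 halfLine := w.isH10.1.2.2.1

theorem H10.memLp_deriv (w : H10) : MemLp (deriv w.fn) 2 halfLine := w.isH10.1.2.2.2

/-- The embedding `w ↦ (w, w')` of `H¹₀(0, +∞)` into `L² × L²` with the Hilbert norm. -/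
noncomputable def H10.embed :
    H10 →+ WithLp 2 (Lp Plane 2 halfLine × Lp Plane 2 halfLine) :=
  AddMonoidHom.mk'
    (fun w => WithLp.toLp 2 (w.memLp.toLp w.fn, w.memLp_deriv.toLp (deriv w.fn)))
    (fun z w => by
      have h1 : (z + w).memLp.toLp (z + w).fn = z.memLp.toLp z.fn + w.memLp.toLp w.fn :=
        MemLp.toLp_add z.memLp w.memLp
      have h2 : (z + w).memLp_deriv.toLp (deriv (z + w).fn) =
          z.memLp_deriv.toLp (deriv z.fn) + w.memLp_deriv.toLp (deriv w.fn) := by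
        rw [← MemLp.toLp_add z.memLp_deriv w.memLp_deriv, MemLp.toLp_eq_toLp_iff]
        filter_upwards [z.locAC.ae_differentiableAt, w.locAC.ae_differentiableAt] with x hx kx
        exact deriv_add hx kx
      rw [h1, h2]
      rfl)

theorem LocAC.continuousOn {z : ℝ → Plane} (hz : LocAC z) : ContinuousOn z (Ioi 0) := by
  intro x hx
  have hx : 0 < x := hx
  have h := (hz (x / 2) (x + 1) (by linarith) (by linarith)).continuousOn
  rw [uIcc_of_le (by linarith)] at h
  exact (h.continuousAt (Icc_mem_nhds (by linarith) (by linarith))).continuousWithinAt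

theorem H10.embed_injective : Function.Injective H10.embed := by
  intro z w h
  have h1 : z.memLp.toLp z.fn = w.memLp.toLp w.fn :=
    congrArg (fun p => ((WithLp.equiv 2 _) p).1) h
  rw [MemLp.toLp_eq_toLp_iff] at h1
  have h2 : EqOn z.fn w.fn (Ioi 0) :=
    Measure.eqOn_open_of_ae_eq h1 isOpen_Ioi z.locAC.continuousOn
      w.locAC.continuousOn
  refine Subtype.ext (funext fun x => ?_)
  rcases le_or_gt x 0 with hx | hx
  · exact (z.isH10.1.1 x hx).trans (w.isH10.1.1 x hx).symm
  · exact h2 hx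

/-- The norm of `H¹₀(0, +∞)`. -/
noncomputable instance : NormedAddCommGroup H10 :=
  NormedAddCommGroup.induced H10 _ H10.embed H10.embed_injective

theorem H10.norm_sq (w : H10) :
    ‖w‖ ^ 2 = (∫ x in Ioi 0, ‖w.fn x‖ ^ 2) + ∫ x in Ioi 0, ‖deriv w.fn x‖ ^ 2 := by
  have key : ∀ {f : ℝ → Plane} (hf : MemLp f 2 halfLine),
      ‖hf.toLp f‖ ^ 2 = ∫ x in Ioi 0, ‖f x‖ ^ 2 := by
    intro f hf
    rw [← real_inner_self_eq_norm_sq, L2.inner_def]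
    refine integral_congr_ae ?_
    filter_upwards [hf.coeFn_toLp] with x hx
    rw [hx, real_inner_self_eq_norm_sq]
  have h : ‖w‖ = ‖H10.embed w‖ := rfl
  rw [h, WithLp.prod_norm_sq_eq_of_L2]
  exact congrArg₂ (· + ·) (key w.memLp) (key w.memLp_deriv)

/-! ### Rotation numbers, the functional `j` and the index `i` -/

/-- `θ` is a continuous angular coordinate of `z` on `(0, +∞)`:
`z = (ρ cos θ, ρ sin θ)` with `ρ > 0`. -/
def IsAngle (z : ℝ → Plane) (θ : ℝ → ℝ) : Prop :=
  ContinuousOn θ (Ioi 0) ∧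
    ∀ x > 0, ∃ ρ > 0, z x = !₂[ρ * Real.cos (θ x), ρ * Real.sin (θ x)]

/-- `r = (θ(+∞) - θ(0)) / π` for an angular coordinate `θ` of `z` having finite limits at `0`
and at `+∞`. -/
def IsRot (z : ℝ → Plane) (r : ℝ) : Prop :=
  ∃ (θ : ℝ → ℝ) (θ₀ θ₁ : ℝ), IsAngle z θ ∧ Tendsto θ (𝓝[>] 0) (𝓝 θ₀) ∧
    Tendsto θ atTop (𝓝 θ₁) ∧ r = (θ₁ - θ₀) / Real.pi

/-- `r` is a rotation number of the point `p = (w, lam)`: the rotation number of `w` if `w ≠ 0`,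
and that of a nontrivial solution `z ∈ H¹(0, +∞)` of `J z' + P(x) z = lam z` if `w = 0`. -/
def IsJ (P : ℝ → Mat) (p : (ℝ → Plane) × ℝ) (r : ℝ) : Prop :=
  (p.1 ≠ 0 ∧ IsRot p.1 r) ∨
    (p.1 = 0 ∧ ∃ z, IsH1 z ∧ z ≠ 0 ∧ (∀ᵐ x ∂halfLine, tau P z x = p.2 • z x) ∧ IsRot z r)

/-- The rotation-number functional `j`. -/
noncomputable def j (P : ℝ → Mat) (p : (ℝ → Plane) × ℝ) : ℝ :=
  Classical.epsilon (IsJ P p)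

/-- Some angle `φ ∈ (a, b)` gives the direction of the eigenvectors of `J⁻¹ Pstar` for its negative
eigenvalue `-√(-det Pstar)`, along which the `L²` solutions approach the origin as `x → 0⁺`. -/
def DecayAngleIn (Pstar : Mat) (a b : ℝ) : Prop :=
  ∃ φ ∈ Ioo a b, (J⁻¹ * Pstar) *ᵥ ![Real.cos φ, Real.sin φ] =
    (-√(-Pstar.det)) • ![Real.cos φ, Real.sin φ]

open Classical in
/-- The nodal index: `⌊j⌋` if the decaying direction at zero lies in the first quadrant (mod `π`),
and `⌊j + 1/2⌋` if it lies in the second one. -/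
noncomputable def nodalIndex (P : ℝ → Mat) (Pstar : Mat) (p : (ℝ → Plane) × ℝ) : ℤ :=
  if DecayAngleIn Pstar 0 (Real.pi / 2) then ⌊j P p⌋ else ⌊j P p + 1 / 2⌋

end DiracBif

namespace DiracBif

/-! ### The action of matrices on the plane -/

/-! A point p = (w, λ) of Σ' defines a linear system z' = J M z with M = P − λ − S(x, w(x))
(`coef`). Because S(x, 0) = 0, the function whose rotation defines j solves this system in both
cases, w ≠ 0 and w = 0. At the two ends M is hyperbolic: x^β M → P* and M → P∞ − λ, both symmetric
with negative determinant. For such a limit D the matrix N = JD satisfies N² = κ², κ = √(−det D).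

The tool at both ends is the quadratic energy c‖(N + κ)z‖² − ‖(N − κ)z‖², which increases along
solutions. If z vanishes at both ends, this energy is nonnegative near 0 and nonpositive near +∞,
for every c > 0. Varying c confines z to arbitrarily narrow cones, so its direction converges to the
κ-eigenline of JP* at 0 and to the negative eigenline of J(P∞ − λ) at +∞. Thus the rotation number
exists.

That square integrable solutions belong to H¹ and vanish at both ends also rests on the energy,
multiplied by powers of x (`ClassP.integrableOn_weighted`, `ClassP.h1_of_forced`). The bound det P*
< −1/4 for β = 1 means 2κ > 1, which is what these powers require.

Continuity comes from the Wronskian ⟨Jz, w⟩ = ‖z‖‖w‖ sin(θ − φ) of two decaying solutions whose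
coefficients differ by at most δ. Its derivative is at most δ‖z‖‖w‖; the energies absorb it near the
ends and Grönwall's inequality handles the compact middle. So |sin(θ − φ)| ≤ Cδ on the whole
half-line (`Hyperbolic.wronskian_le`), and the rotation numbers differ by at most Cδ once Cδ < 1
(`IsRot.abs_sub_le`). With δ = 0 this is uniqueness of j; with δ of the order of the H¹ × ℝ distance
(`exists_coef_sub_le`) it is continuity.

For the index, the limit direction at +∞ always lies in the second quadrant mod π and the one at 0
is that of w₁*. Hence j, respectively j + 1/2, never takes an integer value on Σ', and the floor is
locally constant along it. -/

theorem act_mul (A B : Mat) (v : Plane) : act (A * B) v = act A (act B v) := by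
  simp [act, Matrix.toLpLin_apply]

theorem act_add (A B : Mat) (v : Plane) : act (A + B) v = act A v + act B v := by
  simp [act]

theorem act_sub (A B : Mat) (v : Plane) : act (A - B) v = act A v - act B v := by
  simp [act]

theorem act_smul (c : ℝ) (A : Mat) (v : Plane) : act (c • A) v = c • act A v := by
  simp [act]

theorem act_one (v : Plane) : act 1 v = v := by
  simp [act]

theorem act_vadd (A : Mat) (v w : Plane) : act A (v + w) = act A v + act A w := by
  simp [act]

theorem act_vsmul (A : Mat) (c : ℝ) (v : Plane) : act A (c • v) = c • act A v := by
  simp [act]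

theorem act_vneg (A : Mat) (v : Plane) : act A (-v) = -act A v := by
  simp [act]

theorem act_zero (A : Mat) : act A 0 = 0 := by
  simp [act]

theorem norm_act_le (A : Mat) (v : Plane) : ‖act A v‖ ≤ ‖A‖ * ‖v‖ := by
  simpa [act, Matrix.toLpLin_apply] using Matrix.l2_opNorm_mulVec A v

theorem act_apply_zero (A : Mat) (v : Plane) : act A v 0 = A 0 0 * v 0 + A 0 1 * v 1 := by
  simp [act, Matrix.toLpLin_apply]

theorem act_apply_one (A : Mat) (v : Plane) : act A v 1 = A 1 0 * v 0 + A 1 1 * v 1 := by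
  simp [act, Matrix.toLpLin_apply]

theorem plane_inner (v w : Plane) : inner ℝ v w = v 0 * w 0 + v 1 * w 1 := by
  simp [PiLp.inner_apply, Fin.sum_univ_two]; ring

theorem plane_ext {v w : Plane} (h0 : v 0 = w 0) (h1 : v 1 = w 1) : v = w := by
  ext i; fin_cases i
  · exact h0
  · exact h1

theorem act_J_J (v : Plane) : act J (act J v) = -v := by
  apply plane_ext <;> simp [act_apply_zero, act_apply_one, J]

theorem norm_act_J (v : Plane) : ‖act J v‖ = ‖v‖ := by
  rw [← sq_eq_sq₀ (norm_nonneg _) (norm_nonneg _), ← real_inner_self_eq_norm_sq,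
    ← real_inner_self_eq_norm_sq, plane_inner, plane_inner, act_apply_zero, act_apply_one]
  simp [J]; ring

theorem isSymm_off_diag {A : Mat} (hA : A.IsSymm) : A 1 0 = A 0 1 :=
  hA.apply 0 1

/-- The Wronskian identity: the derivative of `⟨J z, w⟩` along `z' = J A z`, `w' = J B w`. -/
theorem inner_wronskian {A : Mat} (hA : A.IsSymm) (B : Mat) (z w : Plane) :
    inner ℝ (act J (act (J * A) z)) w + inner ℝ (act J z) (act (J * B) w) =
      inner ℝ z (act (B - A) w) := by
  have h := isSymm_off_diag hA
  simp only [act_mul, act_J_J, plane_inner, act_apply_zero, act_apply_one, act_sub]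
  simp [J, act_apply_zero, act_apply_one, h]
  ring

/-- The continuous linear map `v ↦ A v`. -/
noncomputable def actL (A : Mat) : Plane →L[ℝ] Plane := Matrix.toEuclideanCLM (n := Fin 2) (𝕜 := ℝ) A

theorem hasDerivAt_act (A : Mat) {z : ℝ → Plane} {z' : Plane} {x : ℝ} (h : HasDerivAt z z' x) :
    HasDerivAt (fun t => act A (z t)) (act A z') x :=
  (actL A).hasFDerivAt.comp_hasDerivAt x h

theorem continuous_act : Continuous fun p : Mat × Plane => act p.1 p.2 := by
  have h : (fun p : Mat × Plane => act p.1 p.2) = fun p => WithLp.toLp 2 (p.1 *ᵥ p.2.ofLp) := by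
    funext p
    simp [act, Matrix.toLpLin_apply]
  rw [h]
  fun_prop

theorem continuous_act_left (A : Mat) : Continuous (act A) := (actL A).continuous

theorem continuousOn_act {A : ℝ → Mat} {z : ℝ → Plane} {I : Set ℝ} (hA : ContinuousOn A I)
    (hz : ContinuousOn z I) : ContinuousOn (fun x => act (A x) (z x)) I :=
  continuous_act.comp_continuousOn (f := fun x => (A x, z x)) (hA.prodMk hz)

/-! ### Hyperbolic matrices and their energies -/

/-- The quadratic energy `c ‖(N + κ) z‖² - ‖(N - κ) z‖²`. -/
noncomputable def energy (N : Mat) (κ c : ℝ) (z : Plane) : ℝ :=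
  c * ‖act (N + κ • 1) z‖ ^ 2 - ‖act (N - κ • 1) z‖ ^ 2

theorem J_mul_eq (D : Mat) : J * D = !![D 1 0, D 1 1; -D 0 0, -D 0 1] := by
  rw [Matrix.eta_fin_two D]
  simp [J]

/-- Cayley–Hamilton: for symmetric D the product JD has trace zero and determinant det D. -/
theorem J_mul_sq {D : Mat} (hD : D.IsSymm) : J * D * (J * D) = (-D.det) • (1 : Mat) := by
  have h := isSymm_off_diag hD
  rw [J_mul_eq]
  ext i k
  fin_cases i <;> fin_cases k <;> simp [Matrix.det_fin_two, h] <;> ring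

/-- As (N − κ)(N + κ) = 0, the images of N + κ and N − κ lie in the eigenspaces of κ and −κ. The two
terms of the energy are therefore the squared sizes of the growing and decaying components. -/
theorem act_add_act {N : Mat} {κ : ℝ} (hN : N * N = (κ ^ 2) • (1 : Mat)) (z : Plane) :
    act (N + κ • 1) (act N z) = κ • act (N + κ • 1) z := by
  have h : act N (act N z) = κ ^ 2 • z := by rw [← act_mul, hN, act_smul, act_one]
  simp only [act_add, act_smul, act_one, h]
  module

theorem act_sub_act {N : Mat} {κ : ℝ} (hN : N * N = (κ ^ 2) • (1 : Mat)) (z : Plane) :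
    act (N - κ • 1) (act N z) = -(κ • act (N - κ • 1) z) := by
  have h : act N (act N z) = κ ^ 2 • z := by rw [← act_mul, hN, act_smul, act_one]
  simp only [act_sub, act_smul, act_one, h]
  module

theorem norm_sq_le_components (N : Mat) (κ : ℝ) (z : Plane) :
    2 * κ ^ 2 * ‖z‖ ^ 2 ≤ ‖act (N + κ • 1) z‖ ^ 2 + ‖act (N - κ • 1) z‖ ^ 2 := by
  have h : act (N + κ • 1) z - act (N - κ • 1) z = (2 * κ) • z := by
    simp only [act_add, act_sub, act_smul, act_one]
    module
  have h1 := norm_sub_le (act (N + κ • 1) z) (act (N - κ • 1) z)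
  rw [h, norm_smul, Real.norm_eq_abs] at h1
  have h2 : (|2 * κ| * ‖z‖) ^ 2 ≤ (‖act (N + κ • 1) z‖ + ‖act (N - κ • 1) z‖) ^ 2 := by
    gcongr
  rw [mul_pow, sq_abs] at h2
  nlinarith [sq_nonneg (‖act (N + κ • 1) z‖ - ‖act (N - κ • 1) z‖)]

/-- The bound of the energy by the norm. -/
noncomputable def energyBound (N : Mat) (κ c : ℝ) : ℝ :=
  |c| * ‖N + κ • (1 : Mat)‖ ^ 2 + ‖N - κ • (1 : Mat)‖ ^ 2

theorem energyBound_nonneg (N : Mat) (κ c : ℝ) : 0 ≤ energyBound N κ c := by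
  unfold energyBound; positivity

theorem abs_energy_le (N : Mat) (κ c : ℝ) (z : Plane) :
    |energy N κ c z| ≤ energyBound N κ c * ‖z‖ ^ 2 := by
  have h1 : ‖act (N + κ • 1) z‖ ^ 2 ≤ (‖N + κ • (1 : Mat)‖ * ‖z‖) ^ 2 := by
    gcongr; exact norm_act_le _ _
  have h2 : ‖act (N - κ • 1) z‖ ^ 2 ≤ (‖N - κ • (1 : Mat)‖ * ‖z‖) ^ 2 := by
    gcongr; exact norm_act_le _ _
  rw [mul_pow] at h1 h2
  unfold energy energyBound
  calc _ ≤ |c * ‖act (N + κ • 1) z‖ ^ 2| + |‖act (N - κ • 1) z‖ ^ 2| := abs_sub _ _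
    _ = |c| * ‖act (N + κ • 1) z‖ ^ 2 + ‖act (N - κ • 1) z‖ ^ 2 := by
      simp only [abs_mul, abs_pow, abs_norm]
    _ ≤ |c| * (‖N + κ • (1 : Mat)‖ ^ 2 * ‖z‖ ^ 2) + ‖N - κ • (1 : Mat)‖ ^ 2 * ‖z‖ ^ 2 := by
      gcongr
    _ = _ := by ring

theorem continuous_energy (N : Mat) (κ c : ℝ) : Continuous (energy N κ c) := by
  unfold energy
  have h1 := continuous_act_left (N + κ • 1)
  have h2 := continuous_act_left (N - κ • 1)
  fun_prop

theorem energy_zero (N : Mat) (κ c : ℝ) : energy N κ c 0 = 0 := by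
  simp [energy, act_zero]

/-- The derivative of the energy along a velocity `z'`. -/
noncomputable def energyDeriv (N : Mat) (κ c : ℝ) (z z' : Plane) : ℝ :=
  2 * c * inner ℝ (act (N + κ • 1) z) (act (N + κ • 1) z') -
    2 * inner ℝ (act (N - κ • 1) z) (act (N - κ • 1) z')

theorem hasDerivAt_energy (N : Mat) (κ c : ℝ) {z : ℝ → Plane} {z' : Plane} {x : ℝ}
    (h : HasDerivAt z z' x) :
    HasDerivAt (fun t => energy N κ c (z t)) (energyDeriv N κ c (z x) z') x := by
  have h1 := ((hasDerivAt_act (N + κ • 1) h).norm_sq.const_mul c).sub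
    (hasDerivAt_act (N - κ • 1) h).norm_sq
  refine HasDerivAt.congr_deriv h1 ?_
  unfold energyDeriv
  ring

theorem energyDeriv_add (N : Mat) (κ c : ℝ) (z a b : Plane) :
    energyDeriv N κ c z (a + b) = energyDeriv N κ c z a + energyDeriv N κ c z b := by
  simp only [energyDeriv, act_vadd, inner_add_right]; ring

theorem energyDeriv_smul (N : Mat) (κ c r : ℝ) (z a : Plane) :
    energyDeriv N κ c z (r • a) = r * energyDeriv N κ c z a := by
  simp only [energyDeriv, act_vsmul, inner_smul_right]; ring

theorem abs_energyDeriv_le (N : Mat) (κ c : ℝ) (z a : Plane) :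
    |energyDeriv N κ c z a| ≤ 2 * energyBound N κ c * (‖z‖ * ‖a‖) := by
  have h : ∀ A : Mat, |inner ℝ (act A z) (act A a)| ≤ ‖A‖ ^ 2 * (‖z‖ * ‖a‖) := fun A =>
    calc _ ≤ ‖act A z‖ * ‖act A a‖ := abs_real_inner_le_norm _ _
      _ ≤ (‖A‖ * ‖z‖) * (‖A‖ * ‖a‖) := by gcongr <;> exact norm_act_le _ _
      _ = _ := by ring
  unfold energyDeriv energyBound
  calc _ ≤ |2 * c * inner ℝ (act (N + κ • 1) z) (act (N + κ • 1) a)| +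
        |2 * inner ℝ (act (N - κ • 1) z) (act (N - κ • 1) a)| := abs_sub _ _
    _ = 2 * |c| * |inner ℝ (act (N + κ • 1) z) (act (N + κ • 1) a)| +
        2 * |inner ℝ (act (N - κ • 1) z) (act (N - κ • 1) a)| := by
      simp only [abs_mul, abs_two]
    _ ≤ 2 * |c| * (‖N + κ • (1 : Mat)‖ ^ 2 * (‖z‖ * ‖a‖)) +
        2 * (‖N - κ • (1 : Mat)‖ ^ 2 * (‖z‖ * ‖a‖)) := by
      gcongr
      · exact h _
      · exact h _
    _ = _ := by ring

/-- Both contributions are positive: the growing component enters the energy with a plus sign, the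
decaying one with a minus sign. -/
theorem energyDeriv_act {N : Mat} {κ : ℝ} (hN : N * N = (κ ^ 2) • (1 : Mat)) (c : ℝ) (z : Plane) :
    energyDeriv N κ c z (act N z) =
      2 * κ * (c * ‖act (N + κ • 1) z‖ ^ 2 + ‖act (N - κ • 1) z‖ ^ 2) := by
  simp only [energyDeriv, act_add_act hN, act_sub_act hN, inner_smul_right, inner_neg_right,
    real_inner_self_eq_norm_sq]
  ring

/-- Along a velocity close to `N z` the energy grows. -/
theorem energyDeriv_lower {N : Mat} {κ c : ℝ} (hκ : 0 < κ) (hc : 0 < c)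
    (hN : N * N = (κ ^ 2) • (1 : Mat)) :
    ∃ ρ > 0, ∃ m > 0, ∀ B : Mat, ‖B - N‖ ≤ ρ → ∀ z, m * ‖z‖ ^ 2 ≤ energyDeriv N κ c z (act B z) := by
  set E := energyBound N κ c with hE
  have hE0 : 0 ≤ E := energyBound_nonneg _ _ _
  have hm : 0 < min c 1 := lt_min hc one_pos
  -- The unperturbed growth is at least 4κ³ min(c, 1)‖z‖²; this radius lets the perturbation B − N
  -- consume at most half of it.
  refine ⟨κ ^ 3 * min c 1 / (E + 1), by positivity, 2 * κ ^ 3 * min c 1, by positivity,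
    fun B hB z => ?_⟩
  have hz : act B z = act N z + act (B - N) z := by rw [act_sub]; abel
  rw [hz, energyDeriv_add, energyDeriv_act hN]
  have h1 := abs_energyDeriv_le N κ c z (act (B - N) z)
  have h2 : ‖z‖ * ‖act (B - N) z‖ ≤ (κ ^ 3 * min c 1 / (E + 1)) * ‖z‖ ^ 2 := by
    calc _ ≤ ‖z‖ * (‖B - N‖ * ‖z‖) := by gcongr; exact norm_act_le _ _
      _ ≤ ‖z‖ * ((κ ^ 3 * min c 1 / (E + 1)) * ‖z‖) := by gcongr
      _ = _ := by ring
  have h3 : 2 * E * ((κ ^ 3 * min c 1 / (E + 1)) * ‖z‖ ^ 2) ≤ 2 * κ ^ 3 * min c 1 * ‖z‖ ^ 2 := by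
    have : E / (E + 1) ≤ 1 := by rw [div_le_one (by positivity)]; linarith
    calc _ = (E / (E + 1)) * (2 * κ ^ 3 * min c 1 * ‖z‖ ^ 2) := by ring
      _ ≤ 1 * (2 * κ ^ 3 * min c 1 * ‖z‖ ^ 2) := by gcongr
      _ = _ := one_mul _
  have h4 : 2 * E * (‖z‖ * ‖act (B - N) z‖) ≤ 2 * κ ^ 3 * min c 1 * ‖z‖ ^ 2 :=
    (mul_le_mul_of_nonneg_left h2 (by positivity)).trans h3
  have h5 := neg_abs_le (energyDeriv N κ c z (act (B - N) z))
  have h6 : min c 1 * (2 * κ ^ 2 * ‖z‖ ^ 2) ≤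
      c * ‖act (N + κ • 1) z‖ ^ 2 + ‖act (N - κ • 1) z‖ ^ 2 := by
    calc _ ≤ min c 1 * (‖act (N + κ • 1) z‖ ^ 2 + ‖act (N - κ • 1) z‖ ^ 2) := by
          gcongr; exact norm_sq_le_components N κ z
      _ = min c 1 * ‖act (N + κ • 1) z‖ ^ 2 + min c 1 * ‖act (N - κ • 1) z‖ ^ 2 := by ring
      _ ≤ c * ‖act (N + κ • 1) z‖ ^ 2 + 1 * ‖act (N - κ • 1) z‖ ^ 2 := by
          gcongr
          · exact min_le_left _ _
          · exact min_le_right _ _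
      _ = _ := by ring
  have h7 : 2 * κ * (min c 1 * (2 * κ ^ 2 * ‖z‖ ^ 2)) ≤
      2 * κ * (c * ‖act (N + κ • 1) z‖ ^ 2 + ‖act (N - κ • 1) z‖ ^ 2) := by gcongr
  nlinarith

/-- For `2 κ > b ≥ 0` the growth of the energy dominates `b` times the energy itself. -/
theorem energyDeriv_lower_sub {N : Mat} {κ b : ℝ} (hκ : b < 2 * κ) (hb : 0 ≤ b)
    (hN : N * N = (κ ^ 2) • (1 : Mat)) :
    ∃ ρ > 0, ∃ m > 0, ∀ B : Mat, ‖B - N‖ ≤ ρ → ∀ z,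
      b * |energy N κ 1 z| + m * ‖z‖ ^ 2 ≤ energyDeriv N κ 1 z (act B z) := by
  set E := energyBound N κ 1 with hE
  have hE0 : 0 ≤ E := energyBound_nonneg _ _ _
  have hκ0 : 0 < κ := by linarith
  set d := 2 * κ - b with hd
  have hd0 : 0 < d := by linarith
  -- After b|energy| is subtracted, the slack d = 2κ − b leaves at least 2κ²d‖z‖²; the perturbation
  -- is allowed half.
  refine ⟨κ ^ 2 * d / (2 * (E + 1)), by positivity, κ ^ 2 * d, by positivity, fun B hB z => ?_⟩
  have hz : act B z = act N z + act (B - N) z := by rw [act_sub]; abel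
  rw [hz, energyDeriv_add, energyDeriv_act hN]
  have h1 := abs_energyDeriv_le N κ 1 z (act (B - N) z)
  have h2 : ‖z‖ * ‖act (B - N) z‖ ≤ (κ ^ 2 * d / (2 * (E + 1))) * ‖z‖ ^ 2 := by
    calc _ ≤ ‖z‖ * (‖B - N‖ * ‖z‖) := by gcongr; exact norm_act_le _ _
      _ ≤ ‖z‖ * ((κ ^ 2 * d / (2 * (E + 1))) * ‖z‖) := by gcongr
      _ = _ := by ring
  have h3 : 2 * E * ((κ ^ 2 * d / (2 * (E + 1))) * ‖z‖ ^ 2) ≤ κ ^ 2 * d * ‖z‖ ^ 2 := by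
    have : E / (E + 1) ≤ 1 := by rw [div_le_one (by positivity)]; linarith
    calc _ = (E / (E + 1)) * (κ ^ 2 * d * ‖z‖ ^ 2) := by field_simp
      _ ≤ 1 * (κ ^ 2 * d * ‖z‖ ^ 2) := by gcongr
      _ = _ := one_mul _
  have h4 : 2 * E * (‖z‖ * ‖act (B - N) z‖) ≤ κ ^ 2 * d * ‖z‖ ^ 2 :=
    (mul_le_mul_of_nonneg_left h2 (by positivity)).trans h3
  have h5 := neg_abs_le (energyDeriv N κ 1 z (act (B - N) z))
  have h6 := norm_sq_le_components N κ z
  set u := ‖act (N + κ • 1) z‖ ^ 2 with hu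
  set v := ‖act (N - κ • 1) z‖ ^ 2 with hv
  have hu0 : 0 ≤ u := by positivity
  have hv0 : 0 ≤ v := by positivity
  have h7 : |energy N κ 1 z| ≤ u + v := by
    unfold energy
    rw [← hu, ← hv, abs_le]; constructor <;> linarith
  have h8 : b * |energy N κ 1 z| ≤ b * (u + v) := by gcongr
  have h9 : d * (2 * κ ^ 2 * ‖z‖ ^ 2) ≤ d * (u + v) := by gcongr
  have h10 : 2 * κ * (1 * u + v) = b * (u + v) + d * (u + v) := by rw [hd]; ring
  nlinarith

/-! ### Calculus on the half-line -/

theorem monotoneOn_of_hasDerivAt {D : Set ℝ} (hD : Convex ℝ D) {f f' : ℝ → ℝ}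
    (hf : ∀ x ∈ D, HasDerivAt f (f' x) x) (h0 : ∀ x ∈ D, 0 ≤ f' x) : MonotoneOn f D :=
  monotoneOn_of_hasDerivWithinAt_nonneg hD
    (fun x hx => (hf x hx).continuousAt.continuousWithinAt)
    (fun x hx => (hf x (interior_subset hx)).hasDerivWithinAt)
    (fun x hx => h0 x (interior_subset hx))

theorem nonneg_of_monotoneOn_Ioc {f : ℝ → ℝ} {b : ℝ} (hf : MonotoneOn f (Ioc 0 b))
    (h0 : Tendsto f (𝓝[>] 0) (𝓝 0)) : ∀ x ∈ Ioc 0 b, 0 ≤ f x := by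
  intro x hx
  refine le_of_tendsto h0 ?_
  filter_upwards [Ioo_mem_nhdsGT hx.1] with t ht
  exact hf ⟨ht.1, ht.2.le.trans hx.2⟩ hx ht.2.le

theorem nonpos_of_monotoneOn_Ici {f : ℝ → ℝ} {a : ℝ} (hf : MonotoneOn f (Ici a))
    (h0 : Tendsto f atTop (𝓝 0)) : ∀ x ∈ Ici a, f x ≤ 0 := by
  intro x hx
  refine ge_of_tendsto h0 ?_
  filter_upwards [eventually_ge_atTop x] with t ht
  exact hf hx (mem_Ici.2 (le_trans hx ht)) ht

theorem hasDerivAt_primitive {E : Type*} [NormedAddCommGroup E] [NormedSpace ℝ E] [CompleteSpace E]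
    {G : ℝ → E} (hG : ContinuousOn G (Ioi 0)) {a x : ℝ} (ha : 0 < a) (hx : 0 < x) :
    HasDerivAt (fun t => ∫ s in a..t, G s) (G x) x := by
  have hsub : uIcc a x ⊆ Ioi 0 := fun t ht => lt_of_lt_of_le (lt_min ha hx) ht.1
  refine intervalIntegral.integral_hasDerivAt_right (hG.mono hsub).intervalIntegrable ?_
    (hG.continuousAt (Ioi_mem_nhds hx))
  exact hG.stronglyMeasurableAtFilter isOpen_Ioi x hx

/-- A locally absolutely continuous function with a continuous derivative is `C¹`. -/
theorem LocAC.hasDerivAt_of_ae {z G : ℝ → Plane} (hz : LocAC z) (hG : ContinuousOn G (Ioi 0))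
    (h : ∀ᵐ x ∂halfLine, deriv z x = G x) {x : ℝ} (hx : 0 < x) : HasDerivAt z (G x) x := by
  set a := x / 2 with ha
  have ha0 : 0 < a := by positivity
  have hab : a < x + 1 := by linarith
  have hsub : uIcc a (x + 1) ⊆ Ioi 0 := by
    rw [uIcc_of_le hab.le]; exact fun t ht => lt_of_lt_of_le ha0 ht.1
  have hΦ : ∀ t ∈ Ioi (0 : ℝ), HasDerivAt (fun t => ∫ s in a..t, G s) (G t) t :=
    fun t ht => hasDerivAt_primitive hG ha0 ht
  have hAC : AbsolutelyContinuousOnInterval (fun t => ∫ s in a..t, G s) a (x + 1) := by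
    obtain ⟨C, hC⟩ := isCompact_uIcc.exists_bound_of_continuousOn (hG.mono hsub)
    refine LipschitzOnWith.absolutelyContinuousOnInterval (K := C.toNNReal) ?_
    refine Convex.lipschitzOnWith_of_nnnorm_hasDerivWithin_le (convex_uIcc _ _)
      (fun t ht => (hΦ t (hsub ht)).hasDerivWithinAt) fun t ht => ?_
    rw [← NNReal.coe_le_coe, coe_nnnorm]
    exact (hC t ht).trans (Real.le_coe_toNNReal C)
  -- An absolutely continuous function with derivative zero almost everywhere is constant, so z
  -- equals the primitive of G up to a constant.
  have hd : ∀ᵐ t, t ∈ uIcc a (x + 1) →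
      HasDerivAt (fun t => z t - ∫ s in a..t, G s) 0 t := by
    have h1 := hz.ae_differentiableAt
    unfold halfLine at h1 h
    rw [ae_restrict_iff' measurableSet_Ioi] at h1 h
    filter_upwards [h1, h] with t h1 h2 ht
    have h3 := (h1 (hsub ht)).hasDerivAt.sub (hΦ t (hsub ht))
    rwa [h2 (hsub ht), sub_self] at h3
  obtain ⟨C, hC⟩ := ((hz a (x + 1) ha0 hab).sub hAC).const_of_ae_hasDerivAt_zero hd
  have heq : z =ᶠ[𝓝 x] fun t => C + ∫ s in a..t, G s := by
    filter_upwards [Ioo_mem_nhds (show a < x by linarith) (show x < x + 1 by linarith)] with t ht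
    have := hC t (by rw [uIcc_of_le hab.le]; exact ⟨ht.1.le, ht.2.le⟩)
    rw [← this]
    simp
  exact ((hΦ x hx).const_add C).congr_of_eventuallyEq heq

/-- Otherwise g(x) ≥ ε/x near 0, which is not integrable. This supplies points tending to 0 at which
boundary terms are small. -/
theorem frequently_mul_lt_of_integrableOn {g : ℝ → ℝ} {r : ℝ} (hr : 0 < r)
    (hg : IntegrableOn g (Ioc 0 r)) {ε : ℝ} (hε : 0 < ε) :
    ∃ᶠ x in 𝓝[>] 0, x * g x < ε := by
  intro h
  have h : ∀ᶠ x in 𝓝[>] 0, ε ≤ x * g x := h.mono fun x hx => not_lt.1 hx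
  obtain ⟨s, hs, hs'⟩ := mem_nhdsGT_iff_exists_Ioc_subset.1 h
  have hs0 : (0 : ℝ) < s := hs
  set t := min s r with ht
  have ht0 : 0 < t := lt_min hs0 hr
  have hint : IntegrableOn (fun x : ℝ => x⁻¹) (Ioc 0 t) := by
    have h1 : IntegrableOn (fun x => ε⁻¹ * g x) (Ioc 0 t) :=
      (hg.mono_set (Ioc_subset_Ioc_right (min_le_right _ _))).const_mul _
    refine Integrable.mono h1 (by fun_prop) ?_
    refine (ae_restrict_iff' measurableSet_Ioc).2 (ae_of_all _ fun x hx => ?_)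
    have h2 : ε ≤ x * g x := hs' ⟨hx.1, hx.2.trans (min_le_left _ _)⟩
    have hx0 : 0 < x := hx.1
    have h3 : 1 ≤ x * (ε⁻¹ * g x) := by
      have : x * (ε⁻¹ * g x) = ε⁻¹ * (x * g x) := by ring
      rw [this, ← div_eq_inv_mul, one_le_div hε]
      exact h2
    rw [Real.norm_eq_abs, Real.norm_eq_abs, abs_of_pos (inv_pos.2 hx0)]
    refine le_trans ?_ (le_abs_self _)
    rw [inv_le_iff_one_le_mul₀' hx0]
    exact h3
  have := (intervalIntegrable_iff_integrableOn_Ioc_of_le ht0.le).2 hint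
  rw [intervalIntegrable_inv_iff] at this
  rcases this with h | h
  · exact ht0.ne h
  · exact h left_mem_uIcc

/-! ### Linear systems `z' = J M z` -/

/-- `z` is a classical solution of `z' = J M(x) z` on `(0, +∞)`. -/
def IsSol (M : ℝ → Mat) (z : ℝ → Plane) : Prop :=
  ∀ x > 0, HasDerivAt z (act (J * M x) (z x)) x

theorem IsSol.continuousOn {M : ℝ → Mat} {z : ℝ → Plane} (hz : IsSol M z) :
    ContinuousOn z (Ioi 0) := fun x hx => (hz x hx).continuousAt.continuousWithinAt

/-- Grönwall's inequality in both directions of time: e^{2Lx}‖z‖² is nondecreasing and e^{−2Lx}‖z‖²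
is nonincreasing. -/
theorem IsSol.norm_le {M : ℝ → Mat} {z : ℝ → Plane} (hz : IsSol M z) {a b L : ℝ} (ha : 0 < a)
    (hL : ∀ x ∈ Icc a b, ‖J * M x‖ ≤ L) {s t : ℝ} (hs : s ∈ Icc a b) (ht : t ∈ Icc a b) :
    ‖z s‖ ≤ Real.exp (L * (b - a)) * ‖z t‖ := by
  have hder : ∀ c : ℝ, ∀ x ∈ Icc a b, HasDerivAt (fun x => Real.exp (2 * c * x) * ‖z x‖ ^ 2)
      (Real.exp (2 * c * x) * (2 * (c * ‖z x‖ ^ 2 + inner ℝ (z x) (act (J * M x) (z x))))) x := by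
    intro c x hx
    have h1 : HasDerivAt (fun x => Real.exp (2 * c * x)) (Real.exp (2 * c * x) * (2 * c)) x := by
      simpa using ((hasDerivAt_id x).const_mul (2 * c)).exp
    refine (h1.mul (hz x (ha.trans_le hx.1)).norm_sq).congr_deriv ?_
    ring
  have hin : ∀ x ∈ Icc a b, |inner ℝ (z x) (act (J * M x) (z x))| ≤ L * ‖z x‖ ^ 2 := by
    intro x hx
    calc _ ≤ ‖z x‖ * ‖act (J * M x) (z x)‖ := abs_real_inner_le_norm _ _
      _ ≤ ‖z x‖ * (L * ‖z x‖) := by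
        gcongr
        exact (norm_act_le _ _).trans (by gcongr; exact hL x hx)
      _ = _ := by ring
  have hL0 : 0 ≤ L := (norm_nonneg _).trans (hL s hs)
  have hsq : ‖z s‖ ^ 2 ≤ (Real.exp (L * (b - a)) * ‖z t‖) ^ 2 := by
    rw [mul_pow, ← Real.exp_nat_mul]
    push_cast
    have key : ∀ c : ℝ, |c| = L → Real.exp (2 * c * s) * ‖z s‖ ^ 2 ≤
        Real.exp (2 * c * t) * ‖z t‖ ^ 2 →
        ‖z s‖ ^ 2 ≤ Real.exp (2 * (L * (b - a))) * ‖z t‖ ^ 2 := by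
      intro c hc h
      have h2 : Real.exp (2 * c * s) > 0 := Real.exp_pos _
      have h3 : ‖z s‖ ^ 2 ≤ Real.exp (2 * c * (t - s)) * ‖z t‖ ^ 2 := by
        have : Real.exp (2 * c * (t - s)) = Real.exp (2 * c * t) / Real.exp (2 * c * s) := by
          rw [← Real.exp_sub]; ring_nf
        rw [this, div_mul_eq_mul_div, le_div_iff₀ h2]
        linarith
      refine h3.trans ?_
      gcongr ?_ * _
      refine Real.exp_le_exp.2 ?_
      have h4 : c * (t - s) ≤ L * (b - a) := by
        calc c * (t - s) ≤ |c| * |t - s| := by rw [← abs_mul]; exact le_abs_self _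
          _ ≤ L * (b - a) := by
            rw [hc]; gcongr
            rw [abs_le]; constructor <;> linarith [hs.1, hs.2, ht.1, ht.2]
      linarith
    rcases le_total s t with hst | hst
    · refine key L (abs_of_nonneg hL0) ?_
      refine monotoneOn_of_hasDerivAt (convex_Icc a b) (hder L) (fun x hx => ?_) hs ht hst
      have := (abs_le.1 (hin x hx)).1
      have : 0 ≤ L * ‖z x‖ ^ 2 + inner ℝ (z x) (act (J * M x) (z x)) := by linarith
      positivity
    · refine key (-L) (by rw [abs_neg, abs_of_nonneg hL0]) ?_
      have hmono := monotoneOn_of_hasDerivAt (convex_Icc a b)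
        (fun x hx => (hder (-L) x hx).neg) (fun x hx => ?_) ht hs hst
      · simpa using hmono
      have := (abs_le.1 (hin x hx)).2
      have : 0 ≤ -(-L * ‖z x‖ ^ 2 + inner ℝ (z x) (act (J * M x) (z x))) := by linarith
      have h5 := mul_nonneg (Real.exp_pos (2 * -L * x)).le this
      linarith
  exact (sq_le_sq₀ (norm_nonneg _) (by positivity)).1 hsq

theorem IsSol.eq_zero {M : ℝ → Mat} (hM : ContinuousOn M (Ioi 0)) {z : ℝ → Plane}
    (hz : IsSol M z) {a : ℝ} (ha : 0 < a) (h0 : z a = 0) {x : ℝ} (hx : 0 < x) : z x = 0 := by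
  have hm : 0 < min a x := lt_min ha hx
  have hsub : Icc (min a x) (max a x) ⊆ Ioi 0 := fun t ht => lt_of_lt_of_le hm ht.1
  obtain ⟨L, hL⟩ := isCompact_Icc.exists_bound_of_continuousOn
    ((continuousOn_const.mul hM).mono hsub : ContinuousOn (fun x => J * M x) _)
  have := hz.norm_le hm hL (s := x) (t := a) ⟨min_le_right _ _, le_max_right _ _⟩
    ⟨min_le_left _ _, le_max_left _ _⟩
  rw [h0, norm_zero, mul_zero] at this
  exact norm_le_zero_iff.1 this

/-- A nonzero solution of `z' = J M(x) z` on `(0, +∞)` that vanishes at both ends. -/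
structure IsDecaying (M : ℝ → Mat) (z : ℝ → Plane) : Prop where
  isSol : IsSol M z
  ne_zero : ∀ x > 0, z x ≠ 0
  tendsto_zero : Tendsto z (𝓝[>] 0) (𝓝 0)
  tendsto_atTop : Tendsto z atTop (𝓝 0)

/-! ### Coefficients that are hyperbolic at both ends -/

/-- Symmetric coefficients with hyperbolic limits: `x ^ β M(x) → Pstar` at `0` and `M(x) → D`
at `+∞`, the limits being of negative determinant. -/
structure Hyperbolic (M : ℝ → Mat) (β : ℝ) (Pstar D : Mat) : Prop where
  continuousOn : ContinuousOn M (Ioi 0)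
  symm : ∀ x > 0, (M x).IsSymm
  one_le_beta : 1 ≤ β
  symm_zero : Pstar.IsSymm
  det_zero : Pstar.det < 0
  tendsto_zero : Tendsto (fun x => x ^ β • M x) (𝓝[>] 0) (𝓝 Pstar)
  symm_atTop : D.IsSymm
  det_atTop : D.det < 0
  tendsto_atTop : Tendsto M atTop (𝓝 D)

/-- The hyperbolicity rate `√(-det D)`. -/
noncomputable def rate (D : Mat) : ℝ := √(-D.det)

theorem rate_pos {D : Mat} (h : D.det < 0) : 0 < rate D := Real.sqrt_pos.2 (by linarith)

theorem rate_sq {D : Mat} (h : D.det < 0) : rate D ^ 2 = -D.det := Real.sq_sqrt (by linarith)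

theorem J_mul_mul_self {D : Mat} (hD : D.IsSymm) (h : D.det < 0) :
    J * D * (J * D) = (rate D ^ 2) • (1 : Mat) := by
  rw [rate_sq h, J_mul_sq hD]

/-- Near an end where the rescaled coefficients converge to `D`, the energy grows, uniformly for
all coefficients near `M`. -/
theorem eventually_energyDeriv_lower {l : Filter ℝ} {s : ℝ → ℝ} {M : ℝ → Mat} {D : Mat}
    (hD : D.IsSymm) (hdet : D.det < 0) (hs : ∀ᶠ x in l, 0 < s x ∧ s x ≤ 1)
    (hM : Tendsto (fun x => s x • M x) l (𝓝 D)) {c : ℝ} (hc : 0 < c) :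
    ∃ δ > 0, ∃ m > 0, ∀ᶠ x in l, ∀ A : Mat, ‖A - M x‖ ≤ δ → ∀ v,
      m * ‖v‖ ^ 2 ≤ energyDeriv (J * D) (rate D) c v (act (J * A) v) := by
  obtain ⟨ρ, hρ, m, hm, h⟩ := energyDeriv_lower (rate_pos hdet) hc (J_mul_mul_self hD hdet)
  -- Half of ρ pays for the convergence of s • M to D, half for the distance from A to M, which s ≤
  -- 1 does not enlarge.
  set d := ρ / (2 * (‖J‖ + 1)) with hd
  have hd0 : 0 < d := by positivity
  refine ⟨d, hd0, m, hm, ?_⟩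
  filter_upwards [hs, Metric.tendsto_nhds.1 hM d hd0] with x hx hxd A hA v
  rw [dist_eq_norm] at hxd
  have h1 : ‖s x • (J * A) - J * D‖ ≤ ρ := by
    have e : s x • (J * A) - J * D = J * ((s x • M x - D) + s x • (A - M x)) := by
      rw [mul_add, mul_sub, mul_smul_comm, mul_smul_comm, mul_sub, smul_sub]; abel
    have h2 : ‖s x • (A - M x)‖ ≤ d := by
      rw [norm_smul, Real.norm_eq_abs, abs_of_pos hx.1]
      calc s x * ‖A - M x‖ ≤ 1 * d := by gcongr; exact hx.2
        _ = d := one_mul d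
    rw [e]
    calc _ ≤ ‖J‖ * ‖(s x • M x - D) + s x • (A - M x)‖ := norm_mul_le _ _
      _ ≤ (‖J‖ + 1) * (d + d) := by
        gcongr
        · linarith
        · exact (norm_add_le _ _).trans (add_le_add hxd.le h2)
      _ = ρ := by rw [hd]; field_simp; ring
  have h3 := h _ h1 v
  rw [act_smul, energyDeriv_smul] at h3
  have h4 : 0 ≤ energyDeriv (J * D) (rate D) c v (act (J * A) v) := by
    by_contra hneg
    have : 0 ≤ m * ‖v‖ ^ 2 := by positivity
    nlinarith [hx.1]
  nlinarith [hx.2]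

theorem eventually_rpow_le_one {β : ℝ} (hβ : 1 ≤ β) :
    ∀ᶠ x : ℝ in 𝓝[>] 0, 0 < x ^ β ∧ x ^ β ≤ 1 := by
  filter_upwards [Ioo_mem_nhdsGT one_pos] with x hx
  exact ⟨Real.rpow_pos_of_pos hx.1 _, Real.rpow_le_one hx.1.le hx.2.le (by linarith)⟩

/-- The constants m and a serve all coefficients within δ of M at once; this is what makes the
Wronskian bound uniform over nearby points. -/
theorem Hyperbolic.near_zero {M : ℝ → Mat} {β : ℝ} {Pstar D : Mat} (h : Hyperbolic M β Pstar D)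
    {c : ℝ} (hc : 0 < c) :
    ∃ δ > 0, ∃ m > 0, ∃ a > 0, ∀ x ∈ Ioc 0 a, ∀ A : Mat, ‖A - M x‖ ≤ δ → ∀ v,
      m * ‖v‖ ^ 2 ≤ energyDeriv (J * Pstar) (rate Pstar) c v (act (J * A) v) := by
  obtain ⟨δ, hδ, m, hm, hev⟩ := eventually_energyDeriv_lower h.symm_zero h.det_zero
    (eventually_rpow_le_one h.one_le_beta) h.tendsto_zero hc
  obtain ⟨a, ha, ha'⟩ := mem_nhdsGT_iff_exists_Ioc_subset.1 hev
  exact ⟨δ, hδ, m, hm, a, ha, fun x hx => ha' hx⟩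

theorem Hyperbolic.near_atTop {M : ℝ → Mat} {β : ℝ} {Pstar D : Mat} (h : Hyperbolic M β Pstar D)
    {c : ℝ} (hc : 0 < c) :
    ∃ δ > 0, ∃ m > 0, ∃ b > 0, ∀ x ∈ Ici b, ∀ A : Mat, ‖A - M x‖ ≤ δ → ∀ v,
      m * ‖v‖ ^ 2 ≤ energyDeriv (J * D) (rate D) c v (act (J * A) v) := by
  obtain ⟨δ, hδ, m, hm, hev⟩ := eventually_energyDeriv_lower (s := fun _ => 1) h.symm_atTop
    h.det_atTop (Eventually.of_forall fun _ => ⟨one_pos, le_rfl⟩)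
    (by simpa using h.tendsto_atTop) hc
  obtain ⟨b, hb⟩ := eventually_atTop.1 hev
  exact ⟨δ, hδ, m, hm, max b 1, by positivity, fun x hx => hb x (le_trans (le_max_left _ _) hx)⟩

/-! ### Narrow cones at the ends -/

theorem IsDecaying.tendsto_energy_zero {M : ℝ → Mat} {z : ℝ → Plane} (hz : IsDecaying M z)
    (N : Mat) (κ c : ℝ) : Tendsto (fun x => energy N κ c (z x)) (𝓝[>] 0) (𝓝 0) := by
  have := ((continuous_energy N κ c).tendsto 0).comp hz.tendsto_zero
  rwa [energy_zero] at this

theorem IsDecaying.tendsto_energy_atTop {M : ℝ → Mat} {z : ℝ → Plane} (hz : IsDecaying M z)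
    (N : Mat) (κ c : ℝ) : Tendsto (fun x => energy N κ c (z x)) atTop (𝓝 0) := by
  have := ((continuous_energy N κ c).tendsto 0).comp hz.tendsto_atTop
  rwa [energy_zero] at this

/-- The energy increases from the limit 0 at 0, hence is nonnegative. This bounds the decaying
component by √c times the growing one, and c is chosen with √c · U ≤ ε. -/
theorem IsDecaying.cone_zero {M : ℝ → Mat} {β : ℝ} {Pstar D : Mat} (h : Hyperbolic M β Pstar D)
    {z : ℝ → Plane} (hz : IsDecaying M z) {ε : ℝ} (hε : 0 < ε) :
    ∀ᶠ x in 𝓝[>] 0, ‖act (J * Pstar - rate Pstar • 1) (z x)‖ ≤ ε * ‖z x‖ := by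
  set U := ‖J * Pstar + rate Pstar • (1 : Mat)‖ with hU
  set c := ε ^ 2 / (U ^ 2 + 1) with hc
  have hc0 : 0 < c := by positivity
  obtain ⟨δ, hδ, m, hm, a, ha, hlow⟩ := h.near_zero hc0
  have hmono := monotoneOn_of_hasDerivAt (convex_Ioc 0 a)
    (fun x hx => hasDerivAt_energy (J * Pstar) (rate Pstar) c (hz.isSol x hx.1))
    (fun x hx => le_trans (by positivity) (hlow x hx (M x) (by simpa using hδ.le) (z x)))
  have hpos := nonneg_of_monotoneOn_Ioc hmono (hz.tendsto_energy_zero _ _ _)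
  filter_upwards [Ioc_mem_nhdsGT ha] with x hx
  have h1 := hpos x hx
  unfold energy at h1
  have h2 : ‖act (J * Pstar + rate Pstar • 1) (z x)‖ ≤ U * ‖z x‖ := norm_act_le _ _
  refine (sq_le_sq₀ (norm_nonneg _) (by positivity)).1 ?_
  calc ‖act (J * Pstar - rate Pstar • 1) (z x)‖ ^ 2
      ≤ c * ‖act (J * Pstar + rate Pstar • 1) (z x)‖ ^ 2 := by linarith
    _ ≤ c * (U * ‖z x‖) ^ 2 := by gcongr
    _ = (U ^ 2 / (U ^ 2 + 1)) * (ε * ‖z x‖) ^ 2 := by rw [hc]; field_simp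
    _ ≤ 1 * (ε * ‖z x‖) ^ 2 := by
      gcongr
      rw [div_le_one (by positivity)]; linarith
    _ = _ := one_mul _

/-- Mirror image of `IsDecaying.cone_zero`: the energy increases to the limit 0, hence is
nonpositive, and a large c makes the growing component small. -/
theorem IsDecaying.cone_atTop {M : ℝ → Mat} {β : ℝ} {Pstar D : Mat} (h : Hyperbolic M β Pstar D)
    {z : ℝ → Plane} (hz : IsDecaying M z) {ε : ℝ} (hε : 0 < ε) :
    ∀ᶠ x in atTop, ‖act (J * D + rate D • 1) (z x)‖ ≤ ε * ‖z x‖ := by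
  set V := ‖J * D - rate D • (1 : Mat)‖ with hV
  set c := (V ^ 2 + 1) / ε ^ 2 with hc
  have hc0 : 0 < c := by positivity
  obtain ⟨δ, hδ, m, hm, b, hb, hlow⟩ := h.near_atTop hc0
  have hmono := monotoneOn_of_hasDerivAt (convex_Ici b)
    (fun x hx => hasDerivAt_energy (J * D) (rate D) c (hz.isSol x (lt_of_lt_of_le hb hx)))
    (fun x hx => le_trans (by positivity) (hlow x hx (M x) (by simpa using hδ.le) (z x)))
  have hneg := nonpos_of_monotoneOn_Ici hmono (hz.tendsto_energy_atTop _ _ _)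
  filter_upwards [eventually_ge_atTop b] with x hx
  have h1 := hneg x hx
  unfold energy at h1
  have h2 : ‖act (J * D - rate D • 1) (z x)‖ ≤ V * ‖z x‖ := norm_act_le _ _
  refine (sq_le_sq₀ (norm_nonneg _) (by positivity)).1 ?_
  have h3 : c * ‖act (J * D + rate D • 1) (z x)‖ ^ 2 ≤ c * (ε * ‖z x‖) ^ 2 := by
    calc c * ‖act (J * D + rate D • 1) (z x)‖ ^ 2
        ≤ ‖act (J * D - rate D • 1) (z x)‖ ^ 2 := by linarith
      _ ≤ (V * ‖z x‖) ^ 2 := by gcongr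
      _ = V ^ 2 * ‖z x‖ ^ 2 := by ring
      _ ≤ (V ^ 2 + 1) * ‖z x‖ ^ 2 := by gcongr; linarith
      _ = c * (ε * ‖z x‖) ^ 2 := by rw [hc]; field_simp
  exact le_of_mul_le_mul_left h3 hc0

/-! ### Stability of directions -/

/-- The Wronskian of two functions. -/
noncomputable def wronskian (z w : ℝ → Plane) (x : ℝ) : ℝ := inner ℝ (act J (z x)) (w x)

theorem abs_wronskian_le (z w : ℝ → Plane) (x : ℝ) : |wronskian z w x| ≤ ‖z x‖ * ‖w x‖ := by
  refine (abs_real_inner_le_norm _ _).trans ?_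
  rw [norm_act_J]

theorem IsSol.hasDerivAt_wronskian {A B : ℝ → Mat} {z w : ℝ → Plane} (hz : IsSol A z)
    (hw : IsSol B w) {x : ℝ} (hx : 0 < x) (hA : (A x).IsSymm) :
    HasDerivAt (wronskian z w) (inner ℝ (z x) (act (B x - A x) (w x))) x := by
  refine ((hasDerivAt_act J (hz x hx)).inner ℝ (hw x hx)).congr_deriv ?_
  rw [← inner_wronskian hA (B x) (z x) (w x), add_comm]

theorem abs_inner_act_le {A : Mat} {δ : ℝ} (hA : ‖A‖ ≤ δ) (z w : Plane) :
    |inner ℝ z (act A w)| ≤ δ * (‖z‖ * ‖w‖) := by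
  calc _ ≤ ‖z‖ * ‖act A w‖ := abs_real_inner_le_norm _ _
    _ ≤ ‖z‖ * (δ * ‖w‖) := by
      gcongr
      exact (norm_act_le _ _).trans (by gcongr)
    _ = _ := by ring

/-- Monotonicity of the Wronskian corrected by energies, in a region where energies grow. -/
theorem monotoneOn_energy_add_wronskian {A B : ℝ → Mat} {z w : ℝ → Plane} (hz : IsSol A z)
    (hw : IsSol B w) {I : Set ℝ} (hI : Convex ℝ I) (hI0 : I ⊆ Ioi 0)
    (hA : ∀ x > 0, (A x).IsSymm) {N : Mat} {κ m δ : ℝ} (hm : 0 < m)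
    (hAB : ∀ x > 0, ‖B x - A x‖ ≤ δ)
    (hz' : ∀ x ∈ I, ∀ v, m * ‖v‖ ^ 2 ≤ energyDeriv N κ 1 v (act (J * A x) v))
    (hw' : ∀ x ∈ I, ∀ v, m * ‖v‖ ^ 2 ≤ energyDeriv N κ 1 v (act (J * B x) v))
    {s σ : ℝ} (hs : 0 < s) (hσ : |σ| = 1) :
    MonotoneOn (fun x => δ / (2 * m) * (s * energy N κ 1 (z x) + s⁻¹ * energy N κ 1 (w x)) +
      σ * wronskian z w x) I := by
  refine monotoneOn_of_hasDerivAt hI (fun x hx =>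
    ((((hasDerivAt_energy N κ 1 (hz x (hI0 hx))).const_mul s).add
      ((hasDerivAt_energy N κ 1 (hw x (hI0 hx))).const_mul s⁻¹)).const_mul (δ / (2 * m))).add
      ((hz.hasDerivAt_wronskian hw (hI0 hx) (hA x (hI0 hx))).const_mul σ)) fun x hx => ?_
  have hδ : 0 ≤ δ := (norm_nonneg _).trans (hAB x (hI0 hx))
  have h1 := abs_inner_act_le (hAB x (hI0 hx)) (z x) (w x)
  have h2 : |σ * inner ℝ (z x) (act (B x - A x) (w x))| ≤ δ * (‖z x‖ * ‖w x‖) := by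
    rwa [abs_mul, hσ, one_mul]
  have h3 := (abs_le.1 h2).1
  have h4 : δ / (2 * m) * (s * (m * ‖z x‖ ^ 2) + s⁻¹ * (m * ‖w x‖ ^ 2)) ≤
      δ / (2 * m) * (s * energyDeriv N κ 1 (z x) (act (J * A x) (z x)) +
        s⁻¹ * energyDeriv N κ 1 (w x) (act (J * B x) (w x))) := by
    gcongr
    · exact hz' x hx _
    · exact hw' x hx _
  have h5 : δ / (2 * m) * (s * (m * ‖z x‖ ^ 2) + s⁻¹ * (m * ‖w x‖ ^ 2)) =
      δ / 2 * (s * ‖z x‖ ^ 2 + s⁻¹ * ‖w x‖ ^ 2) := by field_simp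
  -- The inequality of arithmetic and geometric means; with the factor δ/(2m), the growth of the two
  -- energies exactly covers the bound δ‖z‖‖w‖ on the derivative of the Wronskian.
  have h6 : 2 * (‖z x‖ * ‖w x‖) ≤ s * ‖z x‖ ^ 2 + s⁻¹ * ‖w x‖ ^ 2 := by
    have : s * ‖z x‖ ^ 2 + s⁻¹ * ‖w x‖ ^ 2 - 2 * (‖z x‖ * ‖w x‖) =
        s⁻¹ * (s * ‖z x‖ - ‖w x‖) ^ 2 := by field_simp; ring
    have : 0 ≤ s⁻¹ * (s * ‖z x‖ - ‖w x‖) ^ 2 := by positivity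
    linarith
  have h7 : δ / 2 * (2 * (‖z x‖ * ‖w x‖)) ≤ δ / 2 * (s * ‖z x‖ ^ 2 + s⁻¹ * ‖w x‖ ^ 2) := by gcongr
  linarith

/-- The weight ‖w‖/‖z‖ balances the two energies, so that the bound is the product ‖z‖‖w‖ and not a
sum of squares. The final estimate must be homogeneous in each solution separately, since only
directions matter. -/
theorem energy_pair_le (N : Mat) (κ : ℝ) {z w : Plane} (hz : z ≠ 0) (hw : w ≠ 0) :
    |(‖w‖ / ‖z‖) * energy N κ 1 z + (‖w‖ / ‖z‖)⁻¹ * energy N κ 1 w| ≤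
      2 * energyBound N κ 1 * (‖z‖ * ‖w‖) := by
  have hz0 := norm_pos_iff.2 hz
  have hw0 := norm_pos_iff.2 hw
  calc _ ≤ |(‖w‖ / ‖z‖) * energy N κ 1 z| + |(‖w‖ / ‖z‖)⁻¹ * energy N κ 1 w| := abs_add_le _ _
    _ = (‖w‖ / ‖z‖) * |energy N κ 1 z| + (‖w‖ / ‖z‖)⁻¹ * |energy N κ 1 w| := by
      rw [abs_mul, abs_mul, abs_of_pos (by positivity : 0 < ‖w‖ / ‖z‖),
        abs_of_pos (by positivity : 0 < (‖w‖ / ‖z‖)⁻¹)]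
    _ ≤ (‖w‖ / ‖z‖) * (energyBound N κ 1 * ‖z‖ ^ 2) +
        (‖w‖ / ‖z‖)⁻¹ * (energyBound N κ 1 * ‖w‖ ^ 2) := by
      gcongr
      · exact abs_energy_le _ _ _ _
      · exact abs_energy_le _ _ _ _
    _ = _ := by field_simp; ring

theorem tendsto_wronskian {z w : ℝ → Plane} {l : Filter ℝ}
    (hz : Tendsto z l (𝓝 0)) (hw : Tendsto w l (𝓝 0)) : Tendsto (wronskian z w) l (𝓝 0) := by
  refine squeeze_zero_norm (fun t => abs_wronskian_le z w t) ?_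
  simpa using hz.norm.mul hw.norm

/-- With s frozen at the value ‖w‖/‖z‖ taken at the chosen point x, the corrected Wronskian is
monotone and tends to 0 at 0, hence is nonnegative at x. The signs σ = ±1 give the two sides of the
bound. -/
theorem abs_wronskian_le_near_zero {A B : ℝ → Mat} {z w : ℝ → Plane} (hz : IsDecaying A z)
    (hw : IsDecaying B w) (hA : ∀ x > 0, (A x).IsSymm) {N : Mat} {κ m δ a : ℝ} (hm : 0 < m)
    (hAB : ∀ x > 0, ‖B x - A x‖ ≤ δ)
    (hz' : ∀ x ∈ Ioc 0 a, ∀ v, m * ‖v‖ ^ 2 ≤ energyDeriv N κ 1 v (act (J * A x) v))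
    (hw' : ∀ x ∈ Ioc 0 a, ∀ v, m * ‖v‖ ^ 2 ≤ energyDeriv N κ 1 v (act (J * B x) v)) :
    ∀ x ∈ Ioc 0 a, |wronskian z w x| ≤ energyBound N κ 1 / m * δ * (‖z x‖ * ‖w x‖) := by
  intro x hx
  have hδ : 0 ≤ δ := (norm_nonneg _).trans (hAB x hx.1)
  have hz0 := norm_pos_iff.2 (hz.ne_zero x hx.1)
  have hw0 := norm_pos_iff.2 (hw.ne_zero x hx.1)
  have key : ∀ σ : ℝ, |σ| = 1 → 0 ≤ δ / (2 * m) * ((‖w x‖ / ‖z x‖) * energy N κ 1 (z x) +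
      (‖w x‖ / ‖z x‖)⁻¹ * energy N κ 1 (w x)) + σ * wronskian z w x := by
    intro σ hσ
    refine nonneg_of_monotoneOn_Ioc (monotoneOn_energy_add_wronskian hz.isSol hw.isSol
      (convex_Ioc 0 a) (fun t ht => ht.1) hA hm hAB hz' hw' (by positivity) hσ) ?_ x hx
    simpa using ((((hz.tendsto_energy_zero N κ 1).const_mul (‖w x‖ / ‖z x‖)).add
      ((hw.tendsto_energy_zero N κ 1).const_mul (‖w x‖ / ‖z x‖)⁻¹)).const_mul (δ / (2 * m))).add
      ((tendsto_wronskian hz.tendsto_zero hw.tendsto_zero).const_mul σ)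
  have h1 := key 1 (by simp)
  have h2 := key (-1) (by simp)
  have h3 := (abs_le.1 (energy_pair_le N κ (hz.ne_zero x hx.1) (hw.ne_zero x hx.1))).2
  have h4 := mul_le_mul_of_nonneg_left h3 (show 0 ≤ δ / (2 * m) by positivity)
  have h5 : δ / (2 * m) * (2 * energyBound N κ 1 * (‖z x‖ * ‖w x‖)) =
      energyBound N κ 1 / m * δ * (‖z x‖ * ‖w x‖) := by
    field_simp
  rw [abs_le]; constructor <;> linarith

theorem abs_wronskian_le_near_atTop {A B : ℝ → Mat} {z w : ℝ → Plane} (hz : IsDecaying A z)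
    (hw : IsDecaying B w) (hA : ∀ x > 0, (A x).IsSymm) {N : Mat} {κ m δ b : ℝ} (hm : 0 < m)
    (hb : 0 < b) (hAB : ∀ x > 0, ‖B x - A x‖ ≤ δ)
    (hz' : ∀ x ∈ Ici b, ∀ v, m * ‖v‖ ^ 2 ≤ energyDeriv N κ 1 v (act (J * A x) v))
    (hw' : ∀ x ∈ Ici b, ∀ v, m * ‖v‖ ^ 2 ≤ energyDeriv N κ 1 v (act (J * B x) v)) :
    ∀ x ∈ Ici b, |wronskian z w x| ≤ energyBound N κ 1 / m * δ * (‖z x‖ * ‖w x‖) := by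
  intro x hx
  have hx0 : 0 < x := lt_of_lt_of_le hb hx
  have hδ : 0 ≤ δ := (norm_nonneg _).trans (hAB x hx0)
  have hz0 := norm_pos_iff.2 (hz.ne_zero x hx0)
  have hw0 := norm_pos_iff.2 (hw.ne_zero x hx0)
  have key : ∀ σ : ℝ, |σ| = 1 → δ / (2 * m) * ((‖w x‖ / ‖z x‖) * energy N κ 1 (z x) +
      (‖w x‖ / ‖z x‖)⁻¹ * energy N κ 1 (w x)) + σ * wronskian z w x ≤ 0 := by
    intro σ hσ
    refine nonpos_of_monotoneOn_Ici (monotoneOn_energy_add_wronskian hz.isSol hw.isSol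
      (convex_Ici b) (fun t ht => lt_of_lt_of_le hb ht) hA hm hAB hz' hw' (by positivity) hσ) ?_ x hx
    simpa using ((((hz.tendsto_energy_atTop N κ 1).const_mul (‖w x‖ / ‖z x‖)).add
      ((hw.tendsto_energy_atTop N κ 1).const_mul (‖w x‖ / ‖z x‖)⁻¹)).const_mul (δ / (2 * m))).add
      ((tendsto_wronskian hz.tendsto_atTop hw.tendsto_atTop).const_mul σ)
  have h1 := key 1 (by simp)
  have h2 := key (-1) (by simp)
  have h3 := (abs_le.1 (energy_pair_le N κ (hz.ne_zero x hx0) (hw.ne_zero x hx0))).1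
  have h4 := mul_le_mul_of_nonneg_left h3 (show 0 ≤ δ / (2 * m) by positivity)
  have h5 : δ / (2 * m) * (-(2 * energyBound N κ 1 * (‖z x‖ * ‖w x‖))) =
      -(energyBound N κ 1 / m * δ * (‖z x‖ * ‖w x‖)) := by
    field_simp
  rw [abs_le]; constructor <;> linarith

/-- The derivative of the Wronskian is integrated from a to x; Grönwall's inequality compares ‖z
t‖‖w t‖ with its value at x. -/
theorem abs_wronskian_le_of_left {A B : ℝ → Mat} {z w : ℝ → Plane} (hz : IsSol A z)
    (hw : IsSol B w) (hA : ∀ x > 0, (A x).IsSymm) {δ a b L C : ℝ} (ha : 0 < a) (hC : 0 ≤ C)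
    (hAB : ∀ x > 0, ‖B x - A x‖ ≤ δ) (hLA : ∀ x ∈ Icc a b, ‖J * A x‖ ≤ L)
    (hLB : ∀ x ∈ Icc a b, ‖J * B x‖ ≤ L)
    (hleft : |wronskian z w a| ≤ C * δ * (‖z a‖ * ‖w a‖)) :
    ∀ x ∈ Icc a b, |wronskian z w x| ≤
      (C + |b - a|) * Real.exp (L * (b - a)) ^ 2 * δ * (‖z x‖ * ‖w x‖) := by
  intro x hx
  have hδ : 0 ≤ δ := (norm_nonneg _).trans (hAB a ha)
  generalize hK : Real.exp (L * (b - a)) = K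
  have hgrow : ∀ t ∈ Icc a x, ‖z t‖ * ‖w t‖ ≤ K ^ 2 * (‖z x‖ * ‖w x‖) := by
    intro t ht
    have ht' : t ∈ Icc a b := ⟨ht.1, ht.2.trans hx.2⟩
    have h1 := hz.norm_le ha hLA ht' hx
    have h2 := hw.norm_le ha hLB ht' hx
    rw [hK] at h1 h2
    have := mul_le_mul h1 h2 (norm_nonneg _) ((norm_nonneg _).trans h1)
    linarith
  have ha' : |wronskian z w a| ≤ C * δ * (K ^ 2 * (‖z x‖ * ‖w x‖)) :=
    hleft.trans (mul_le_mul_of_nonneg_left (hgrow a ⟨le_rfl, hx.1⟩) (by positivity))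
  have hdiff : ‖wronskian z w x - wronskian z w a‖ ≤
      δ * (K ^ 2 * (‖z x‖ * ‖w x‖)) * ‖x - a‖ := by
    refine Convex.norm_image_sub_le_of_norm_hasDerivWithin_le (s := Icc a x)
      (f' := fun t => inner ℝ (z t) (act (B t - A t) (w t)))
      (fun t ht => (hz.hasDerivAt_wronskian hw (ha.trans_le ht.1)
        (hA t (ha.trans_le ht.1))).hasDerivWithinAt) (fun t ht => ?_) (convex_Icc a x)
      ⟨le_rfl, hx.1⟩ ⟨hx.1, le_rfl⟩
    exact (abs_inner_act_le (hAB t (ha.trans_le ht.1)) _ _).trans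
      (mul_le_mul_of_nonneg_left (hgrow t ht) hδ)
  rw [Real.norm_eq_abs, Real.norm_eq_abs] at hdiff
  have hxa : |x - a| ≤ |b - a| := by
    rw [abs_of_nonneg (by linarith [hx.1]), abs_of_nonneg (by linarith [hx.1, hx.2])]
    linarith [hx.2]
  calc |wronskian z w x| = |(wronskian z w x - wronskian z w a) + wronskian z w a| := by
        rw [sub_add_cancel]
    _ ≤ _ := abs_add_le _ _
    _ ≤ δ * (K ^ 2 * (‖z x‖ * ‖w x‖)) * |b - a| + C * δ * (K ^ 2 * (‖z x‖ * ‖w x‖)) :=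
        add_le_add (hdiff.trans (mul_le_mul_of_nonneg_left hxa (by positivity))) ha'
    _ = _ := by ring

/-- Decaying solutions for nearby coefficients are nearly parallel, uniformly on `(0, +∞)`. -/
theorem Hyperbolic.wronskian_le {M₀ : ℝ → Mat} {β : ℝ} {Pstar D : Mat}
    (h : Hyperbolic M₀ β Pstar D) :
    ∃ C > 0, ∃ δ₀ > 0, ∀ δ ≤ δ₀, ∀ M : ℝ → Mat, (∀ x > 0, ‖M x - M₀ x‖ ≤ δ) →
      ∀ z w, IsDecaying M₀ z → IsDecaying M w → ∀ x > 0,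
        |wronskian z w x| ≤ C * δ * (‖z x‖ * ‖w x‖) := by
  obtain ⟨δ₁, hδ₁, m₁, hm₁, a, ha, hlow₁⟩ := h.near_zero one_pos
  obtain ⟨δ₂, hδ₂, m₂, hm₂, b, hb, hlow₂⟩ := h.near_atTop one_pos
  have hsub : Icc a b ⊆ Ioi 0 := fun t ht => lt_of_lt_of_le ha ht.1
  obtain ⟨L, hL⟩ := isCompact_Icc.exists_bound_of_continuousOn
    ((continuousOn_const.mul h.continuousOn).mono hsub : ContinuousOn (fun x => J * M₀ x) _)
  obtain ⟨C₁, hC₁0, hC₁⟩ : ∃ C, 0 ≤ C ∧ energyBound (J * Pstar) (rate Pstar) 1 / m₁ = C :=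
    ⟨_, div_nonneg (energyBound_nonneg _ _ _) hm₁.le, rfl⟩
  obtain ⟨C₂, hC₂0, hC₂⟩ : ∃ C, 0 ≤ C ∧ energyBound (J * D) (rate D) 1 / m₂ = C :=
    ⟨_, div_nonneg (energyBound_nonneg _ _ _) hm₂.le, rfl⟩
  -- For every admissible M the norm of JM on [a, b] is at most L + ‖J‖ min(δ₁, δ₂), so the Grönwall
  -- factor does not depend on M. Since a ≤ b is not known, the length enters as |b − a|.
  obtain ⟨C₃, hC₃0, hC₃⟩ : ∃ C, 0 ≤ C ∧
      (C₁ + |b - a|) * Real.exp ((L + ‖J‖ * min δ₁ δ₂) * (b - a)) ^ 2 = C :=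
    ⟨_, by positivity, rfl⟩
  refine ⟨C₁ + C₂ + C₃ + 1, by positivity, min δ₁ δ₂, lt_min hδ₁ hδ₂,
    fun δ hδ M hM z w hz hw x hx => ?_⟩
  have hδ0 : 0 ≤ δ := (norm_nonneg _).trans (hM x hx)
  have hself : ∀ x, ∀ r : ℝ, 0 < r → ‖M₀ x - M₀ x‖ ≤ r := fun x r hr => by simpa using hr.le
  have hzw : 0 ≤ δ * (‖z x‖ * ‖w x‖) := by positivity
  have hzero := abs_wronskian_le_near_zero hz hw h.symm hm₁ hM
    (fun t ht => hlow₁ t ht (M₀ t) (hself t δ₁ hδ₁))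
    (fun t ht => hlow₁ t ht (M t) ((hM t ht.1).trans (hδ.trans (min_le_left _ _))))
  have htop := abs_wronskian_le_near_atTop hz hw h.symm hm₂ hb hM
    (fun t ht => hlow₂ t ht (M₀ t) (hself t δ₂ hδ₂))
    (fun t ht => hlow₂ t ht (M t)
      ((hM t (lt_of_lt_of_le hb ht)).trans (hδ.trans (min_le_right _ _))))
  rw [hC₁] at hzero
  rw [hC₂] at htop
  rcases le_or_gt x a with hxa | hxa
  · have := hzero x ⟨hx, hxa⟩
    nlinarith
  rcases le_or_gt x b with hxb | hxb
  · have hJδ : 0 ≤ ‖J‖ * min δ₁ δ₂ := mul_nonneg (norm_nonneg _) (le_min hδ₁.le hδ₂.le)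
    have := abs_wronskian_le_of_left hz.isSol hw.isSol h.symm (L := L + ‖J‖ * min δ₁ δ₂)
      ha hC₁0 hM (fun y hy => (hL y hy).trans (le_add_of_nonneg_right hJδ)) (fun y hy => by
        have e : J * M y = J * M₀ y + J * (M y - M₀ y) := by rw [mul_sub]; abel
        rw [e]
        refine (norm_add_le _ _).trans (add_le_add (hL y hy) ((norm_mul_le _ _).trans ?_))
        exact mul_le_mul_of_nonneg_left ((hM y (hsub hy)).trans hδ) (norm_nonneg _))
      (hzero a ⟨ha, le_rfl⟩) x ⟨hxa.le, hxb⟩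
    rw [hC₃] at this
    nlinarith
  · have := htop x hxb.le
    nlinarith

/-! ### Angular coordinates -/

/-- The unit vector of angle `θ`. -/
noncomputable def dir (θ : ℝ) : Plane := !₂[Real.cos θ, Real.sin θ]

theorem dir_zero (θ : ℝ) : dir θ 0 = Real.cos θ := rfl

theorem dir_one (θ : ℝ) : dir θ 1 = Real.sin θ := rfl

theorem norm_dir (θ : ℝ) : ‖dir θ‖ = 1 := by
  have h : ‖dir θ‖ ^ 2 = 1 := by
    rw [← real_inner_self_eq_norm_sq, plane_inner, dir_zero, dir_one]
    nlinarith [Real.sin_sq_add_cos_sq θ]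
  exact (pow_eq_one_iff_of_nonneg (norm_nonneg _) two_ne_zero).1 h

theorem continuous_dir : Continuous dir := by
  unfold dir
  fun_prop

theorem polar_eq (ρ θ : ℝ) : (!₂[ρ * Real.cos θ, ρ * Real.sin θ] : Plane) = ρ • dir θ := by
  apply plane_ext <;> simp [dir]

theorem IsAngle.eq_smul {z : ℝ → Plane} {θ : ℝ → ℝ} (h : IsAngle z θ) {x : ℝ} (hx : 0 < x) :
    z x = ‖z x‖ • dir (θ x) := by
  obtain ⟨ρ, hρ, hz⟩ := h.2 x hx
  rw [polar_eq] at hz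
  have : ‖z x‖ = ρ := by rw [hz, norm_smul, norm_dir, mul_one, Real.norm_eq_abs, abs_of_pos hρ]
  rw [this]
  exact hz

theorem inner_act_J_dir (θ φ : ℝ) : inner ℝ (act J (dir θ)) (dir φ) = Real.sin (θ - φ) := by
  rw [plane_inner, act_apply_zero, act_apply_one, Real.sin_sub]
  simp [J, dir]
  ring

theorem IsAngle.wronskian_eq {z w : ℝ → Plane} {θ φ : ℝ → ℝ} (hz : IsAngle z θ) (hw : IsAngle w φ)
    {x : ℝ} (hx : 0 < x) : wronskian z w x = ‖z x‖ * ‖w x‖ * Real.sin (θ x - φ x) := by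
  have h : wronskian z w x = inner ℝ (act J (‖z x‖ • dir (θ x))) (‖w x‖ • dir (φ x)) := by
    rw [← hz.eq_smul hx, ← hw.eq_smul hx]; rfl
  rw [h, act_vsmul, real_inner_smul_left, real_inner_smul_right, inner_act_J_dir]
  ring

/-- On a connected set, a continuous function whose sine never reaches `±1` stays near a single
multiple of `π`. -/
theorem exists_int_abs_sub_le {D : Set ℝ} (hD : IsPreconnected D) {ψ : ℝ → ℝ}
    (hψ : ContinuousOn ψ D) (hsin : ∀ x ∈ D, |Real.sin (ψ x)| < 1) :
    ∃ k : ℤ, ∀ x ∈ D, |ψ x - k * Real.pi| ≤ Real.pi / 2 * |Real.sin (ψ x)| := by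
  rcases D.eq_empty_or_nonempty with rfl | ⟨x₀, hx₀⟩
  · exact ⟨0, by simp⟩
  set k := round (ψ x₀ / Real.pi) with hk
  have hπ := Real.pi_pos
  have hne : ∀ x ∈ D, ∀ s : ℝ, |s| = 1 → ψ x ≠ s * (Real.pi / 2) + k * Real.pi := by
    intro x hx s hs h
    have h1 := hsin x hx
    rw [h, Real.sin_add_int_mul_pi, abs_mul, abs_zpow, abs_neg, abs_one, one_zpow, one_mul] at h1
    rcases (abs_eq (by norm_num)).1 hs with rfl | rfl <;> simp at h1
  -- Intermediate values: to leave the strip of half-width π/2 around kπ, ψ would have to take a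
  -- value where the sine is ±1.
  have hord : (ψ '' D).OrdConnected := (hD.image ψ hψ).ordConnected
  have h0 : |ψ x₀ - k * Real.pi| ≤ Real.pi / 2 := by
    have h := abs_sub_round (ψ x₀ / Real.pi)
    have e : ψ x₀ - k * Real.pi = (ψ x₀ / Real.pi - k) * Real.pi := by field_simp
    rw [e, abs_mul, abs_of_pos hπ]
    nlinarith
  have hlt : ∀ x ∈ D, |ψ x - k * Real.pi| < Real.pi / 2 := by
    intro x hx
    rw [abs_lt]
    rw [abs_le] at h0
    constructor
    · by_contra hcon
      obtain ⟨y, hy, hy'⟩ := hord.out (mem_image_of_mem ψ hx) (mem_image_of_mem ψ hx₀)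
        (show -1 * (Real.pi / 2) + k * Real.pi ∈ Icc (ψ x) (ψ x₀) from
          ⟨by linarith, by linarith⟩)
      exact hne y hy (-1) (by simp) hy'
    · by_contra hcon
      obtain ⟨y, hy, hy'⟩ := hord.out (mem_image_of_mem ψ hx₀) (mem_image_of_mem ψ hx)
        (show 1 * (Real.pi / 2) + k * Real.pi ∈ Icc (ψ x₀) (ψ x) from
          ⟨by linarith, by linarith⟩)
      exact hne y hy 1 (by simp) hy'
  refine ⟨k, fun x hx => ?_⟩
  have h1 := Real.mul_abs_le_abs_sin (hlt x hx).le
  rw [Real.sin_sub_int_mul_pi, abs_mul, abs_zpow, abs_neg, abs_one, one_zpow, one_mul] at h1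
  calc |ψ x - k * Real.pi| = Real.pi / 2 * (2 / Real.pi * |ψ x - k * Real.pi|) := by field_simp
    _ ≤ _ := by gcongr

/-- A nonvanishing `C¹` curve in the plane has a continuous angular coordinate. -/
theorem exists_isAngle {z z' : ℝ → Plane} (hz : ∀ x > 0, HasDerivAt z (z' x) x)
    (hz' : ContinuousOn z' (Ioi 0)) (h0 : ∀ x > 0, z x ≠ 0) : ∃ θ, IsAngle z θ := by
  have hcoord : ∀ (i : Fin 2), ∀ x > 0, HasDerivAt (fun t => z t i) (z' x i) x := fun i x hx =>
    (EuclideanSpace.proj i : Plane →L[ℝ] ℝ).hasFDerivAt.comp_hasDerivAt x (hz x hx)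
  set ζ : ℝ → ℂ := fun x => (z x 0 : ℂ) + (z x 1 : ℂ) * Complex.I with hζ
  set ζ' : ℝ → ℂ := fun x => (z' x 0 : ℂ) + (z' x 1 : ℂ) * Complex.I with hζ'
  have hder : ∀ x > 0, HasDerivAt ζ (ζ' x) x := fun x hx =>
    (hcoord 0 x hx).ofReal_comp.add ((hcoord 1 x hx).ofReal_comp.mul_const Complex.I)
  have hne : ∀ x > 0, ζ x ≠ 0 := by
    intro x hx h
    refine h0 x hx (plane_ext ?_ ?_)
    · simpa [hζ] using congrArg Complex.re h
    · simpa [hζ] using congrArg Complex.im h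
  have hcont' : ContinuousOn ζ' (Ioi 0) := by
    have h : ∀ i : Fin 2, ContinuousOn (fun x => z' x i) (Ioi 0) := fun i =>
      (EuclideanSpace.proj i : Plane →L[ℝ] ℝ).continuous.comp_continuousOn hz'
    have h1 := Complex.continuous_ofReal.comp_continuousOn (h 0)
    have h2 := Complex.continuous_ofReal.comp_continuousOn (h 1)
    exact h1.add (h2.mul continuousOn_const)
  have hcont : ContinuousOn ζ (Ioi 0) := fun x hx =>
    (hder x hx).continuousAt.continuousWithinAt
  have hg : ContinuousOn (fun x => ζ' x / ζ x) (Ioi 0) := hcont'.div hcont hne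
  -- A logarithm of ζ obtained by integrating ζ'/ζ; its imaginary part is the angle.
  set l : ℝ → ℂ := fun x => Complex.log (ζ 1) + ∫ s in (1 : ℝ)..x, ζ' s / ζ s with hl
  have hlder : ∀ x > 0, HasDerivAt l (ζ' x / ζ x) x := fun x hx =>
    (hasDerivAt_primitive hg one_pos hx).const_add _
  have hF : ∀ x > 0, HasDerivAt (fun t => ζ t * Complex.exp (-l t)) 0 x := by
    intro x hx
    refine ((hder x hx).mul ((hlder x hx).neg.cexp)).congr_deriv ?_
    have := hne x hx
    field_simp
    ring
  have hconst : ∀ x > 0, ζ x = Complex.exp (l x) := by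
    intro x hx
    have h1 := (convex_Ioi (0 : ℝ)).norm_image_sub_le_of_norm_hasDerivWithin_le (C := 0)
      (fun t ht => (hF t ht).hasDerivWithinAt) (fun t _ => by simp)
      (mem_Ioi.2 one_pos) (mem_Ioi.2 hx)
    rw [zero_mul] at h1
    have h2 : ζ x * Complex.exp (-l x) = 1 := by
      have h3 := sub_eq_zero.1 (norm_le_zero_iff.1 h1)
      have h4 : l 1 = Complex.log (ζ 1) := by simp [hl]
      rw [h3, h4, Complex.exp_neg, Complex.exp_log (hne 1 one_pos),
        mul_inv_cancel₀ (hne 1 one_pos)]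
    rw [Complex.exp_neg, mul_inv_eq_one₀ (Complex.exp_ne_zero _)] at h2
    exact h2
  refine ⟨fun x => (l x).im, ?_, fun x hx => ⟨Real.exp (l x).re, Real.exp_pos _, ?_⟩⟩
  · exact Complex.continuous_im.comp_continuousOn
      fun x hx => (hlder x hx).continuousAt.continuousWithinAt
  · have h := hconst x hx
    apply plane_ext
    · have := congrArg Complex.re h
      rw [Complex.exp_re] at this
      simpa [hζ] using this
    · have := congrArg Complex.im h
      rw [Complex.exp_im] at this
      simpa [hζ] using this

theorem exists_eq_smul_dir (v : Plane) : ∃ φ, v = ‖v‖ • dir φ := by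
  refine ⟨(Complex.arg ⟨v 0, v 1⟩), ?_⟩
  have hn : ‖(⟨v 0, v 1⟩ : ℂ)‖ = ‖v‖ := by
    rw [EuclideanSpace.norm_eq, Complex.norm_eq_sqrt_sq_add_sq]
    simp [Fin.sum_univ_two]
  apply plane_ext
  · have := Complex.norm_mul_cos_arg ⟨v 0, v 1⟩
    rw [hn] at this
    simpa [dir] using this.symm
  · have := Complex.norm_mul_sin_arg ⟨v 0, v 1⟩
    rw [hn] at this
    simpa [dir] using this.symm

theorem exists_act_dir_eq_zero {A : Mat} (hA : A.det = 0) : ∃ φ, act A (dir φ) = 0 := by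
  obtain ⟨v, hv, hv'⟩ := Matrix.exists_mulVec_eq_zero_iff.2 hA
  set w : Plane := WithLp.toLp 2 v with hw
  have hw0 : w ≠ 0 := by
    intro h
    apply hv
    have := congrArg WithLp.ofLp h
    simpa [hw] using this
  have hAw : act A w = 0 := by
    simp [act, hw, hv']
  obtain ⟨φ, hφ⟩ := exists_eq_smul_dir w
  refine ⟨φ, ?_⟩
  rw [hφ, act_vsmul] at hAw
  exact (smul_eq_zero.1 hAw).resolve_left (norm_ne_zero_iff.2 hw0)

theorem dir_decomp (θ φ : ℝ) :
    dir θ = Real.cos (θ - φ) • dir φ + Real.sin (θ - φ) • dir (φ + Real.pi / 2) := by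
  have h := Real.sin_sq_add_cos_sq φ
  apply plane_ext <;>
    simp only [PiLp.add_apply, PiLp.smul_apply, dir_zero, dir_one, smul_eq_mul,
      Real.cos_add_pi_div_two, Real.sin_add_pi_div_two, Real.cos_sub, Real.sin_sub]
  · linear_combination (-Real.cos θ) * h
  · linear_combination (-Real.sin θ) * h

/-- On unit vectors a singular matrix only sees the sine of the angle to its kernel, so smallness of
A on a direction becomes smallness of a sine. -/
theorem act_dir_of_kernel {A : Mat} {φ : ℝ} (hφ : act A (dir φ) = 0) (θ : ℝ) :
    act A (dir θ) = Real.sin (θ - φ) • act A (dir (φ + Real.pi / 2)) := by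
  rw [dir_decomp θ φ, act_vadd, act_vsmul, act_vsmul, hφ, smul_zero, zero_add]

theorem act_dir_ne_zero {A : Mat} (hA : A ≠ 0) {φ : ℝ} (hφ : act A (dir φ) = 0) :
    act A (dir (φ + Real.pi / 2)) ≠ 0 := by
  intro h
  apply hA
  have h1 : ∀ θ, act A (dir θ) = 0 := fun θ => by rw [act_dir_of_kernel hφ, h, smul_zero]
  have h2 := h1 0
  have h3 := h1 (Real.pi / 2)
  have e1 := congrArg (fun v : Plane => v 0) h2
  have e2 := congrArg (fun v : Plane => v 1) h2
  have e3 := congrArg (fun v : Plane => v 0) h3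
  have e4 := congrArg (fun v : Plane => v 1) h3
  simp only [act_apply_zero, act_apply_one, dir_zero, dir_one] at e1 e2 e3 e4
  simp at e1 e2 e3 e4
  ext i j
  fin_cases i <;> fin_cases j <;> simpa

/-- An angular coordinate along which a singular nonzero matrix tends to vanish converges. -/
theorem exists_tendsto_of_act_dir {A : Mat} (hA : A.det = 0) (hA0 : A ≠ 0) {l : Filter ℝ}
    (hl : ∀ s ∈ l, ∃ t ∈ l, t ⊆ s ∧ IsPreconnected t) {θ : ℝ → ℝ} (hθ : ∀ᶠ x in l, ContinuousAt θ x)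
    (h : Tendsto (fun x => act A (dir (θ x))) l (𝓝 0)) : ∃ θ₁, Tendsto θ l (𝓝 θ₁) := by
  obtain ⟨φ, hφ⟩ := exists_act_dir_eq_zero hA
  have hne := norm_pos_iff.2 (act_dir_ne_zero hA0 hφ)
  have hsin : Tendsto (fun x => |Real.sin (θ x - φ)|) l (𝓝 0) := by
    have h1 := h.norm.div_const ‖act A (dir (φ + Real.pi / 2))‖
    rw [norm_zero, zero_div] at h1
    refine h1.congr fun x => ?_
    rw [act_dir_of_kernel hφ, norm_smul, Real.norm_eq_abs, mul_div_cancel_right₀ _ hne.ne']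
  -- Connected members of the filter keep θ − φ near one and the same multiple of π; `hl` covers
  -- both 𝓝[>] 0 and `atTop`.
  obtain ⟨D, hDl, hDsub, hD⟩ := hl _ (hθ.and (hsin.eventually_lt_const one_pos))
  obtain ⟨k, hk⟩ := exists_int_abs_sub_le hD (ψ := fun x => θ x - φ)
    (fun x hx => (hDsub hx).1.continuousWithinAt.sub continuousWithinAt_const)
    (fun x hx => (hDsub hx).2)
  refine ⟨k * Real.pi + φ, ?_⟩
  rw [tendsto_iff_norm_sub_tendsto_zero]
  refine squeeze_zero' (Eventually.of_forall fun _ => norm_nonneg _) ?_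
    (by simpa using hsin.const_mul (Real.pi / 2))
  filter_upwards [hDl] with x hx
  have := hk x hx
  rwa [Real.norm_eq_abs, show θ x - (k * Real.pi + φ) = θ x - φ - k * Real.pi by ring]

/-- JD has eigenvalues ±κ, so JD + κ is singular; its trace 2κ is not zero. Its kernel is therefore
a line, which fixes the limit direction mod π. -/
theorem det_add_rate {D : Mat} (hD : D.IsSymm) (h : D.det < 0) :
    (J * D + rate D • (1 : Mat)).det = 0 ∧ J * D + rate D • (1 : Mat) ≠ 0 := by
  have hs := isSymm_off_diag hD
  have hr := rate_sq h
  rw [Matrix.det_fin_two, hs] at hr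
  constructor
  · rw [J_mul_eq, Matrix.det_fin_two]
    simp [hs]
    linarith
  · intro h0
    have e0 := congrFun (congrFun h0 0) 0
    have e1 := congrFun (congrFun h0 1) 1
    rw [J_mul_eq] at e0 e1
    simp [hs] at e0 e1
    linarith [rate_pos h]

theorem det_sub_rate {D : Mat} (hD : D.IsSymm) (h : D.det < 0) :
    (J * D - rate D • (1 : Mat)).det = 0 ∧ J * D - rate D • (1 : Mat) ≠ 0 := by
  have hs := isSymm_off_diag hD
  have hr := rate_sq h
  rw [Matrix.det_fin_two, hs] at hr
  constructor
  · rw [J_mul_eq, Matrix.det_fin_two]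
    simp [hs]
    linarith
  · intro h0
    have e0 := congrFun (congrFun h0 0) 0
    have e1 := congrFun (congrFun h0 1) 1
    rw [J_mul_eq] at e0 e1
    simp [hs] at e0 e1
    linarith [rate_pos h]

/-! ### Rotation numbers of decaying solutions -/

theorem IsAngle.norm_act_dir {z : ℝ → Plane} {θ : ℝ → ℝ} (h : IsAngle z θ) (A : Mat) {x ε : ℝ}
    (hx : 0 < x) (hA : ‖act A (z x)‖ ≤ ε * ‖z x‖) : ‖act A (dir (θ x))‖ ≤ ε := by
  obtain ⟨ρ, hρ, hz⟩ := h.2 x hx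
  rw [polar_eq] at hz
  rw [hz, act_vsmul, norm_smul, norm_smul, norm_dir, Real.norm_eq_abs, abs_of_pos hρ] at hA
  nlinarith

theorem IsDecaying.tendsto_act_dir_zero {M : ℝ → Mat} {β : ℝ} {Pstar D : Mat}
    (h : Hyperbolic M β Pstar D) {z : ℝ → Plane} (hz : IsDecaying M z) {θ : ℝ → ℝ}
    (hθ : IsAngle z θ) :
    Tendsto (fun x => act (J * Pstar - rate Pstar • 1) (dir (θ x))) (𝓝[>] 0) (𝓝 0) := by
  rw [Metric.tendsto_nhds]
  intro ε hε
  filter_upwards [hz.cone_zero h (half_pos hε), self_mem_nhdsWithin] with x hx hx0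
  rw [dist_zero_right]
  exact (hθ.norm_act_dir _ hx0 hx).trans_lt (half_lt_self hε)

theorem IsDecaying.tendsto_act_dir_atTop {M : ℝ → Mat} {β : ℝ} {Pstar D : Mat}
    (h : Hyperbolic M β Pstar D) {z : ℝ → Plane} (hz : IsDecaying M z) {θ : ℝ → ℝ}
    (hθ : IsAngle z θ) :
    Tendsto (fun x => act (J * D + rate D • 1) (dir (θ x))) atTop (𝓝 0) := by
  rw [Metric.tendsto_nhds]
  intro ε hε
  filter_upwards [hz.cone_atTop h (half_pos hε), eventually_gt_atTop 0] with x hx hx0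
  rw [dist_zero_right]
  exact (hθ.norm_act_dir _ hx0 hx).trans_lt (half_lt_self hε)

theorem IsDecaying.act_limit_zero {M : ℝ → Mat} {β : ℝ} {Pstar D : Mat}
    (h : Hyperbolic M β Pstar D) {z : ℝ → Plane} (hz : IsDecaying M z) {θ : ℝ → ℝ}
    (hθ : IsAngle z θ) {θ₀ : ℝ} (hlim : Tendsto θ (𝓝[>] 0) (𝓝 θ₀)) :
    act (J * Pstar - rate Pstar • 1) (dir θ₀) = 0 := by
  have hc : Continuous fun t => act (J * Pstar - rate Pstar • 1) (dir t) :=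
    (continuous_act_left _).comp continuous_dir
  exact tendsto_nhds_unique ((hc.tendsto θ₀).comp hlim) (hz.tendsto_act_dir_zero h hθ)

theorem IsDecaying.act_limit_atTop {M : ℝ → Mat} {β : ℝ} {Pstar D : Mat}
    (h : Hyperbolic M β Pstar D) {z : ℝ → Plane} (hz : IsDecaying M z) {θ : ℝ → ℝ}
    (hθ : IsAngle z θ) {θ₁ : ℝ} (hlim : Tendsto θ atTop (𝓝 θ₁)) :
    act (J * D + rate D • 1) (dir θ₁) = 0 := by
  have hc : Continuous fun t => act (J * D + rate D • 1) (dir t) :=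
    (continuous_act_left _).comp continuous_dir
  exact tendsto_nhds_unique ((hc.tendsto θ₁).comp hlim) (hz.tendsto_act_dir_atTop h hθ)

theorem IsDecaying.exists_isRot {M : ℝ → Mat} {β : ℝ} {Pstar D : Mat}
    (h : Hyperbolic M β Pstar D) {z : ℝ → Plane} (hz : IsDecaying M z) : ∃ r, IsRot z r := by
  obtain ⟨θ, hθ⟩ := exists_isAngle hz.isSol (continuousOn_act
    (continuousOn_const.mul h.continuousOn) hz.isSol.continuousOn) hz.ne_zero
  have hcont : ∀ x ∈ Ioi (0 : ℝ), ContinuousAt θ x := fun x hx =>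
    hθ.1.continuousAt (Ioi_mem_nhds hx)
  obtain ⟨θ₀, h₀⟩ := exists_tendsto_of_act_dir (det_sub_rate h.symm_zero h.det_zero).1
    (det_sub_rate h.symm_zero h.det_zero).2 (fun s hs => by
      obtain ⟨b, hb, hb'⟩ := mem_nhdsGT_iff_exists_Ioc_subset.1 hs
      exact ⟨Ioc 0 b, Ioc_mem_nhdsGT hb, hb', isPreconnected_Ioc⟩)
    (eventually_mem_nhdsWithin.mono hcont) (hz.tendsto_act_dir_zero h hθ)
  obtain ⟨θ₁, h₁⟩ := exists_tendsto_of_act_dir (det_add_rate h.symm_atTop h.det_atTop).1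
    (det_add_rate h.symm_atTop h.det_atTop).2 (fun s hs => by
      obtain ⟨b, hb⟩ := mem_atTop_sets.1 hs
      exact ⟨Ici b, Ici_mem_atTop b, hb, isPreconnected_Ici⟩)
    ((eventually_gt_atTop 0).mono hcont) (hz.tendsto_act_dir_atTop h hθ)
  exact ⟨_, θ, θ₀, θ₁, hθ, h₀, h₁, rfl⟩

/-- Functions that are nearly parallel at every point have close rotation numbers. -/
theorem IsRot.abs_sub_le {z w : ℝ → Plane} (hz0 : ∀ x > 0, z x ≠ 0) (hw0 : ∀ x > 0, w x ≠ 0)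
    {η : ℝ} (hη : η < 1) (hzw : ∀ x > 0, |wronskian z w x| ≤ η * (‖z x‖ * ‖w x‖)) {r r' : ℝ}
    (hr : IsRot z r) (hr' : IsRot w r') : |r - r'| ≤ η := by
  obtain ⟨θ, θ₀, θ₁, hθ, hθ₀, hθ₁, rfl⟩ := hr
  obtain ⟨φ, φ₀, φ₁, hφ, hφ₀, hφ₁, rfl⟩ := hr'
  have hπ := Real.pi_pos
  have hsin : ∀ x ∈ Ioi (0 : ℝ), |Real.sin (θ x - φ x)| ≤ η := by
    intro x hx
    have h1 := hzw x hx
    have h2 : 0 < ‖z x‖ * ‖w x‖ :=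
      mul_pos (norm_pos_iff.2 (hz0 x hx)) (norm_pos_iff.2 (hw0 x hx))
    rw [hθ.wronskian_eq hφ hx, abs_mul, abs_of_pos h2, mul_comm] at h1
    exact le_of_mul_le_mul_right h1 h2
  obtain ⟨k, hk⟩ := exists_int_abs_sub_le isPreconnected_Ioi (ψ := fun x => θ x - φ x)
    (hθ.1.sub hφ.1) (fun x hx => (hsin x hx).trans_lt hη)
  have hk' : ∀ x ∈ Ioi (0 : ℝ), |θ x - φ x - k * Real.pi| ≤ Real.pi / 2 * η := fun x hx =>
    (hk x hx).trans (mul_le_mul_of_nonneg_left (hsin x hx) (by positivity))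
  have h0 : |θ₀ - φ₀ - k * Real.pi| ≤ Real.pi / 2 * η :=
    le_of_tendsto ((hθ₀.sub hφ₀).sub_const _).abs
      (eventually_mem_nhdsWithin.mono hk')
  have h1 : |θ₁ - φ₁ - k * Real.pi| ≤ Real.pi / 2 * η :=
    le_of_tendsto ((hθ₁.sub hφ₁).sub_const _).abs ((eventually_gt_atTop 0).mono hk')
  -- The half-line is connected, so the same k serves at both ends and cancels. Two errors of (π/2)η
  -- then add up to πη.
  have e : (θ₁ - θ₀) / Real.pi - (φ₁ - φ₀) / Real.pi =
      ((θ₁ - φ₁ - k * Real.pi) - (θ₀ - φ₀ - k * Real.pi)) / Real.pi := by ring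
  rw [e, abs_div, abs_of_pos hπ, div_le_iff₀ hπ]
  calc _ ≤ |θ₁ - φ₁ - k * Real.pi| + |θ₀ - φ₀ - k * Real.pi| := abs_sub _ _
    _ ≤ _ := by linarith

/-! ### Square integrable solutions of the inhomogeneous system -/

theorem ClassP.det_neg {μm μp : ℝ} {P : ℝ → Mat} {β : ℝ} {Pstar : Mat}
    (hP : ClassP μm μp P β Pstar) : Pstar.det < 0 := by
  rcases hP.one_le_beta.eq_or_lt with h | h
  · linarith [hP.det_of_eq_one h.symm]
  · exact hP.det_of_one_lt h

/-- For β = 1 the quantity is identically 1, and det P* < −1/4 says 1 < 2κ; for β > 1 it tends to 0.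
-/
theorem ClassP.exists_weight_bound {μm μp : ℝ} {P : ℝ → Mat} {β : ℝ} {Pstar : Mat}
    (hP : ClassP μm μp P β Pstar) :
    ∃ b, 0 ≤ b ∧ b < 2 * rate Pstar ∧ ∀ᶠ x : ℝ in 𝓝[>] 0, β * x ^ (β - 1) ≤ b := by
  have hr := rate_pos hP.det_neg
  rcases hP.one_le_beta.eq_or_lt with h | h
  · refine ⟨1, zero_le_one, ?_, Eventually.of_forall fun x => by simp [← h]⟩
    have h1 := rate_sq hP.det_neg
    have h2 := hP.det_of_eq_one h.symm
    nlinarith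
  · refine ⟨rate Pstar, hr.le, by linarith, ?_⟩
    have hc : Tendsto (fun x : ℝ => β * x ^ (β - 1)) (𝓝 0) (𝓝 (β * 0 ^ (β - 1))) :=
      ((Real.continuousAt_rpow_const 0 (β - 1) (Or.inr (by linarith))).tendsto).const_mul β
    rw [Real.zero_rpow (by linarith), mul_zero] at hc
    exact (hc.mono_left nhdsWithin_le_nhds).eventually_le_const hr

/-- Differentiating x^γ Q produces γ/x · Q. Since β/x = βx^{β−1} · x^{−β}, this term is dominated by
the growth of the energy whenever |γ| ≤ β, with a multiple of x^{−β}‖z‖² to spare. -/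
theorem ClassP.energyDeriv_lower {μm μp : ℝ} {P : ℝ → Mat} {β : ℝ} {Pstar : Mat}
    (hP : ClassP μm μp P β Pstar) :
    ∃ m > 0, ∃ a > 0, a ≤ 1 ∧ ∀ x ∈ Ioc 0 a, ∀ v,
      β / x * |energy (J * Pstar) (rate Pstar) 1 v| + m * (x ^ β)⁻¹ * ‖v‖ ^ 2 ≤
        energyDeriv (J * Pstar) (rate Pstar) 1 v (act (J * P x) v) := by
  obtain ⟨b, hb0, hb, hev⟩ := hP.exists_weight_bound
  obtain ⟨ρ, hρ, m, hm, hlow⟩ := energyDeriv_lower_sub hb hb0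
    (J_mul_mul_self hP.symm_star hP.det_neg)
  have hlim : Tendsto (fun x => x ^ β • (J * P x)) (𝓝[>] 0) (𝓝 (J * Pstar)) := by
    simpa using hP.tendsto_zero.const_mul J
  obtain ⟨a, ha, ha'⟩ := mem_nhdsGT_iff_exists_Ioc_subset.1
    (hev.and (Metric.tendsto_nhds.1 hlim ρ hρ))
  refine ⟨m, hm, min a 1, lt_min ha one_pos, min_le_right _ _, fun x hx v => ?_⟩
  obtain ⟨h1, h2⟩ := ha' ⟨hx.1, hx.2.trans (min_le_left _ _)⟩
  rw [dist_eq_norm] at h2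
  have h3 := hlow _ h2.le v
  have hx0 : 0 < x := hx.1
  have hxβ : 0 < x ^ β := Real.rpow_pos_of_pos hx0 β
  rw [act_smul, energyDeriv_smul, mul_comm (x ^ β), ← div_le_iff₀ hxβ] at h3
  refine le_trans ?_ h3
  have h4 : β / x ≤ b * (x ^ β)⁻¹ := by
    rw [Real.rpow_sub hx0, Real.rpow_one] at h1
    calc β / x = (β * (x ^ β / x)) * (x ^ β)⁻¹ := by field_simp
      _ ≤ _ := by gcongr
  calc _ ≤ b * (x ^ β)⁻¹ * |energy (J * Pstar) (rate Pstar) 1 v| + m * (x ^ β)⁻¹ * ‖v‖ ^ 2 := by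
        gcongr
    _ = _ := by ring

/-- The energy inequality for the system with a forcing term. -/
theorem ClassP.energyDeriv_forced {μm μp : ℝ} {P : ℝ → Mat} {β : ℝ} {Pstar : Mat}
    (hP : ClassP μm μp P β Pstar) :
    ∃ m > 0, ∃ C ≥ 0, ∃ a > 0, a ≤ 1 ∧ ∀ x ∈ Ioc 0 a, ∀ v f,
      β / x * |energy (J * Pstar) (rate Pstar) 1 v| + m * (x ^ β)⁻¹ * ‖v‖ ^ 2
          - C * x ^ β * ‖f‖ ^ 2 ≤
        energyDeriv (J * Pstar) (rate Pstar) 1 v (act (J * P x) v - act J f) := by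
  obtain ⟨m, hm, a, ha, ha1, hlow⟩ := hP.energyDeriv_lower
  set E := energyBound (J * Pstar) (rate Pstar) 1 with hE
  refine ⟨m / 2, by positivity, 2 * E ^ 2 / m, by positivity, a, ha, ha1, fun x hx v f => ?_⟩
  have h1 := hlow x hx v
  have h2 := abs_energyDeriv_le (J * Pstar) (rate Pstar) 1 v (act J (-f))
  rw [norm_act_J, norm_neg] at h2
  have h3 := (abs_le.1 h2).1
  rw [show act (J * P x) v - act J f = act (J * P x) v + act J (-f) by
    rw [act_vneg, sub_eq_add_neg], energyDeriv_add]
  have hxβ : 0 < x ^ β := Real.rpow_pos_of_pos hx.1 β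
  -- Young's inequality with weight x^β: half of the coercive term absorbs the factor ‖v‖, which is
  -- why m is halved.
  have h4 : 2 * E * (‖v‖ * ‖f‖) ≤
      m / 2 * (x ^ β)⁻¹ * ‖v‖ ^ 2 + 2 * E ^ 2 / m * x ^ β * ‖f‖ ^ 2 := by
    have e : m / 2 * (x ^ β)⁻¹ * ‖v‖ ^ 2 + 2 * E ^ 2 / m * x ^ β * ‖f‖ ^ 2
        - 2 * E * (‖v‖ * ‖f‖) = (x ^ β)⁻¹ / (2 * m) * (m * ‖v‖ - 2 * E * x ^ β * ‖f‖) ^ 2 := by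
      field_simp
      ring
    have : 0 ≤ (x ^ β)⁻¹ / (2 * m) * (m * ‖v‖ - 2 * E * x ^ β * ‖f‖) ^ 2 := by positivity
    linarith
  linarith

theorem hasDerivAt_rpow_mul {Q : ℝ → ℝ} {Q' x : ℝ} (hx : 0 < x) (hQ : HasDerivAt Q Q' x) (γ : ℝ) :
    HasDerivAt (fun t => t ^ γ * Q t) (x ^ γ * (γ / x * Q x + Q')) x := by
  refine ((Real.hasDerivAt_rpow_const (Or.inl hx.ne')).mul hQ).congr_deriv ?_
  rw [Real.rpow_sub_one hx.ne']
  field_simp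

/-- Near the singularity, square integrable solutions of the forced system are square integrable
with the weight `x ^ (-β)`. -/
theorem ClassP.integrableOn_weighted {μm μp : ℝ} {P : ℝ → Mat} {β : ℝ} {Pstar : Mat}
    (hP : ClassP μm μp P β Pstar) {z f : ℝ → Plane} (hf : ContinuousOn f (Ioi 0))
    (hf2 : IntegrableOn (fun x => ‖f x‖ ^ 2) (Ioi 0))
    (hz2 : IntegrableOn (fun x => ‖z x‖ ^ 2) (Ioi 0))
    (hz : ∀ x > 0, HasDerivAt z (act (J * P x) (z x) - act J (f x)) x) :
    ∃ a > 0, a ≤ 1 ∧ IntegrableOn (fun x => ((x ^ β)⁻¹ * ‖z x‖) ^ 2) (Ioc 0 a) := by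
  obtain ⟨m, hm, C, hC, a, ha, ha1, hlow⟩ := hP.energyDeriv_forced
  have hβ := hP.one_le_beta
  refine ⟨a, ha, ha1, ?_⟩
  generalize hN : J * Pstar = N at hlow
  generalize hκ : rate Pstar = κ at hlow
  set E := energyBound N κ 1 with hE
  have hE0 : 0 ≤ E := energyBound_nonneg _ _ _
  set Q : ℝ → ℝ := fun x => energy N κ 1 (z x) with hQ
  set F : ℝ → ℝ := fun x => ∫ s in a..x, ‖f s‖ ^ 2 with hF
  have hfc : ContinuousOn (fun s => ‖f s‖ ^ 2) (Ioi 0) := hf.norm.pow 2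
  have hzc : ContinuousOn z (Ioi 0) := fun x hx => (hz x hx).continuousAt.continuousWithinAt
  have hFd : ∀ x > 0, HasDerivAt F (‖f x‖ ^ 2) x := fun x hx => hasDerivAt_primitive hfc ha hx
  have hQd : ∀ x > 0, HasDerivAt Q (energyDeriv N κ 1 (z x) (act (J * P x) (z x) - act J (f x))) x :=
    fun x hx => hasDerivAt_energy N κ 1 (hz x hx)
  obtain ⟨F₀, hF₀⟩ : ∃ F₀, (∫ x in Ioc 0 a, ‖f x‖ ^ 2) = F₀ := ⟨_, rfl⟩
  have hF0 : ∀ x ∈ Ioc 0 a, F x ≤ 0 ∧ -F₀ ≤ F x := by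
    intro x hx
    have e : F x = -∫ s in Ioc x a, ‖f s‖ ^ 2 := by
      rw [hF]
      change ∫ s in a..x, ‖f s‖ ^ 2 = _
      rw [intervalIntegral.integral_symm, intervalIntegral.integral_of_le hx.2]
    constructor
    · rw [e, neg_nonpos]
      exact integral_nonneg fun s => by positivity
    · rw [e, neg_le_neg_iff, ← hF₀]
      exact setIntegral_mono_set (hf2.mono_set Ioc_subset_Ioi_self)
        (ae_of_all _ fun s => by positivity) (Ioc_subset_Ioc_left hx.1.le).eventuallyLE
  -- a lower bound of the energy
  have hQlow : ∀ ε ∈ Ioc 0 a, -(C * ε ^ β * F₀) ≤ Q ε := by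
    intro ε hε
    have hε0 : 0 < ε := hε.1
    -- The exponent 1 is admissible because 1 ≤ β, and it is the power for which integrability of
    -- ‖z‖² makes x Q(x) small along points tending to 0. The primitive F compensates the forcing.
    have hmono : MonotoneOn (fun x => x ^ (1 : ℝ) * Q x + C * ε ^ (1 + β) * F x) (Ioc 0 ε) := by
      refine monotoneOn_of_hasDerivAt (convex_Ioc 0 ε) (fun x hx =>
        (hasDerivAt_rpow_mul hx.1 (hQd x hx.1) 1).add ((hFd x hx.1).const_mul _)) fun x hx => ?_
      have hx0 : 0 < x := hx.1
      have h1 := hlow x ⟨hx.1, hx.2.trans hε.2⟩ (z x) (f x)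
      have h2 : x ^ (1 + β) ≤ ε ^ (1 + β) := Real.rpow_le_rpow hx0.le hx.2 (by linarith)
      rw [Real.rpow_add hx0, Real.rpow_one] at h2
      rw [Real.rpow_one]
      have h3 : 0 ≤ m * (x ^ β)⁻¹ * ‖z x‖ ^ 2 := by
        have := Real.rpow_pos_of_pos hx0 β
        positivity
      have h4 : 0 ≤ 1 / x * Q x + β / x * |Q x| := by
        have h5 : 1 / x * |Q x| ≤ β / x * |Q x| := by gcongr
        have h6 : 1 / x * -|Q x| ≤ 1 / x * Q x :=
          mul_le_mul_of_nonneg_left (neg_abs_le _) (by positivity)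
        linarith
      have h7 : -(C * x ^ β * ‖f x‖ ^ 2) ≤ 1 / x * Q x +
          energyDeriv N κ 1 (z x) (act (J * P x) (z x) - act J (f x)) := by
        have : |Q x| = |energy N κ 1 (z x)| := rfl
        linarith
      have h8 := mul_le_mul_of_nonneg_left h7 hx0.le
      have h9 : C * (x * x ^ β) * ‖f x‖ ^ 2 ≤ C * ε ^ (1 + β) * ‖f x‖ ^ 2 := by gcongr
      nlinarith
    have hη : ∀ η > 0, -(C * ε ^ (1 + β) * F₀) - η ≤ ε * Q ε := by
      intro η hη
      have hfreq := frequently_mul_lt_of_integrableOn (g := fun x => E * ‖z x‖ ^ 2) ha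
        ((hz2.mono_set Ioc_subset_Ioi_self).const_mul E) hη
      obtain ⟨x, hx, hxε⟩ := (hfreq.and_eventually (Ioc_mem_nhdsGT hε0)).exists
      have h1 := hmono hxε ⟨hε0, le_rfl⟩ hxε.2
      simp only [Real.rpow_one] at h1
      have h2 : -(E * ‖z x‖ ^ 2) ≤ Q x := (abs_le.1 (abs_energy_le N κ 1 (z x))).1
      have h3 := mul_le_mul_of_nonneg_left h2 hxε.1.le
      have h4 : C * ε ^ (1 + β) * F ε ≤ 0 :=
        mul_nonpos_of_nonneg_of_nonpos (by positivity) (hF0 ε hε).1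
      have h5 : C * ε ^ (1 + β) * -F₀ ≤ C * ε ^ (1 + β) * F x :=
        mul_le_mul_of_nonneg_left (hF0 x ⟨hxε.1, hxε.2.trans hε.2⟩).2 (by positivity)
      linarith
    have h1 : -(C * ε ^ (1 + β) * F₀) ≤ ε * Q ε := le_of_forall_pos_sub_le hη
    rw [Real.rpow_add hε0, Real.rpow_one] at h1
    have h2 : ε * -(C * ε ^ β * F₀) ≤ ε * Q ε := by linarith
    exact le_of_mul_le_mul_left h2 hε0
  -- the weighted integral
  have hgc : ContinuousOn (fun x : ℝ => ((x ^ β)⁻¹ * ‖z x‖) ^ 2) (Ioi 0) := by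
    refine ContinuousOn.pow (ContinuousOn.mul (ContinuousOn.inv₀ ?_ ?_) hzc.norm) 2
    · exact fun x hx => (Real.continuousAt_rpow_const x β (Or.inl (ne_of_gt hx))).continuousWithinAt
    · exact fun x hx => (Real.rpow_pos_of_pos hx β).ne'
  set G : ℝ → ℝ := fun x => ∫ s in a..x, ((s ^ β)⁻¹ * ‖z s‖) ^ 2 with hG
  have hGd : ∀ x > 0, HasDerivAt G (((x ^ β)⁻¹ * ‖z x‖) ^ 2) x :=
    fun x hx => hasDerivAt_primitive hgc ha hx
  -- With the weight x^{−β} the coercive term becomes exactly the integrand of G, and the forcing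
  -- becomes C‖f‖².
  have hmono : MonotoneOn (fun x => x ^ (-β) * Q x + C * F x - m * G x) (Ioc 0 a) := by
    refine monotoneOn_of_hasDerivAt (convex_Ioc 0 a) (fun x hx =>
      ((hasDerivAt_rpow_mul hx.1 (hQd x hx.1) (-β)).add ((hFd x hx.1).const_mul C)).sub
        ((hGd x hx.1).const_mul m)) fun x hx => ?_
    have hx0 : 0 < x := hx.1
    have hxβ := Real.rpow_pos_of_pos hx0 β
    have h1 := hlow x hx (z x) (f x)
    rw [Real.rpow_neg hx0.le]
    have h2 : β / x * Q x ≤ β / x * |Q x| := by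
      gcongr; exact le_abs_self _
    have h3 : m * (x ^ β)⁻¹ * ‖z x‖ ^ 2 - C * x ^ β * ‖f x‖ ^ 2 ≤ -β / x * Q x +
        energyDeriv N κ 1 (z x) (act (J * P x) (z x) - act J (f x)) := by
      have : |Q x| = |energy N κ 1 (z x)| := rfl
      have e : -β / x * Q x = -(β / x * Q x) := by ring
      linarith
    have h4 := mul_le_mul_of_nonneg_left h3 (inv_pos.2 hxβ).le
    have e : (x ^ β)⁻¹ * (m * (x ^ β)⁻¹ * ‖z x‖ ^ 2 - C * x ^ β * ‖f x‖ ^ 2) =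
        m * ((x ^ β)⁻¹ * ‖z x‖) ^ 2 - C * ‖f x‖ ^ 2 := by
      field_simp
    linarith
  -- `hQlow` keeps the boundary term −x^{−β}Q(x) bounded as x → 0: its bound Cx^βF₀ becomes the
  -- constant CF₀.
  have hbound : ∀ x ∈ Ioc 0 a, m * (∫ s in Ioc x a, ((s ^ β)⁻¹ * ‖z s‖) ^ 2) ≤
      a ^ (-β) * Q a + 2 * C * F₀ := by
    intro x hx
    have hx0 : 0 < x := hx.1
    have h1 := hmono hx ⟨ha, le_rfl⟩ hx.2
    have hFa : F a = 0 := by simp [hF]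
    have hGa : G a = 0 := by simp [hG]
    have hGx : G x = -∫ s in Ioc x a, ((s ^ β)⁻¹ * ‖z s‖) ^ 2 := by
      change ∫ s in a..x, ((s ^ β)⁻¹ * ‖z s‖) ^ 2 = _
      rw [intervalIntegral.integral_symm, intervalIntegral.integral_of_le hx.2]
    simp only [hFa, hGa, hGx, mul_zero, add_zero, sub_zero] at h1
    have h2 := mul_le_mul_of_nonneg_left (hQlow x hx) (Real.rpow_pos_of_pos hx0 (-β)).le
    have h3 : x ^ (-β) * -(C * x ^ β * F₀) = -(C * F₀) := by
      have := Real.rpow_pos_of_pos hx0 β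
      rw [Real.rpow_neg hx0.le]; field_simp
    have h4 := mul_le_mul_of_nonneg_left (hF0 x hx).2 hC
    linarith
  have hseq : ∀ n : ℕ, a / ((n : ℝ) + 1) ∈ Ioc 0 a := fun n =>
    ⟨by positivity, div_le_self ha.le (by linarith [(Nat.cast_nonneg n : (0 : ℝ) ≤ n)])⟩
  refine integrableOn_Ioc_of_intervalIntegral_norm_bounded_left (l := (atTop : Filter ℕ))
    (a := fun n => a / ((n : ℝ) + 1)) (I := (a ^ (-β) * Q a + 2 * C * F₀) / m) (fun n => ?_) ?_
    (Eventually.of_forall fun n => ?_)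
  · refine (ContinuousOn.integrableOn_Icc (hgc.mono fun x hx => ?_)).mono_set Ioc_subset_Icc_self
    exact lt_of_lt_of_le (hseq n).1 hx.1
  · simpa [div_eq_mul_inv] using (tendsto_one_div_add_atTop_nhds_zero_nat (𝕜 := ℝ)).const_mul a
  · rw [le_div_iff₀ hm, mul_comm]
    simpa only [Real.norm_of_nonneg (sq_nonneg _)] using hbound _ (hseq n)

theorem memLp_two_iff_integrableOn {f : ℝ → Plane} (hf : ContinuousOn f (Ioi 0)) :
    MemLp f 2 halfLine ↔ IntegrableOn (fun x => ‖f x‖ ^ 2) (Ioi 0) :=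
  memLp_two_iff_integrable_sq_norm (hf.aestronglyMeasurable measurableSet_Ioi)

theorem ClassP.exists_norm_bound {μm μp : ℝ} {P : ℝ → Mat} {β : ℝ} {Pstar : Mat}
    (hP : ClassP μm μp P β Pstar) {c : ℝ} (hc : 0 < c) : ∃ R, ∀ x ≥ c, ‖P x‖ ≤ R := by
  obtain ⟨b, hb⟩ := eventually_atTop.1 (hP.tendsto_atTop.norm.eventually_le_const
    (lt_add_one ‖Pinf μm μp‖))
  obtain ⟨R, hR⟩ := (isCompact_Icc (a := c) (b := b)).exists_bound_of_continuousOn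
    (hP.continuousOn.mono fun x hx => lt_of_lt_of_le hc hx.1)
  refine ⟨max R (‖Pinf μm μp‖ + 1), fun x hx => ?_⟩
  rcases le_total x b with h | h
  · exact (hR x ⟨hx, h⟩).trans (le_max_left _ _)
  · exact (hb x h).trans (le_max_right _ _)

/-- If `‖z‖²` and `‖z'‖²` are integrable on `(0, +∞)`, so is `⟨z, z'⟩`. -/
theorem integrableOn_inner {z z' : ℝ → Plane} (hz : ContinuousOn z (Ioi 0))
    (hz' : ContinuousOn z' (Ioi 0)) (hz2 : IntegrableOn (fun x => ‖z x‖ ^ 2) (Ioi 0))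
    (hz2' : IntegrableOn (fun x => ‖z' x‖ ^ 2) (Ioi 0)) :
    IntegrableOn (fun x => 2 * inner ℝ (z x) (z' x)) (Ioi 0) := by
  refine Integrable.mono (hz2.add hz2')
    ((continuousOn_const.mul (hz.inner hz')).aestronglyMeasurable measurableSet_Ioi)
    (ae_of_all _ fun x => ?_)
  rw [Real.norm_eq_abs, Pi.add_apply, Real.norm_eq_abs, abs_of_nonneg (by positivity :
    0 ≤ ‖z x‖ ^ 2 + ‖z' x‖ ^ 2), abs_mul, abs_two]
  nlinarith [abs_real_inner_le_norm (z x) (z' x), sq_nonneg (‖z x‖ - ‖z' x‖)]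

theorem tendsto_zero_of_norm_sq {z : ℝ → Plane} {l : Filter ℝ}
    (h : Tendsto (fun x => ‖z x‖ ^ 2) l (𝓝 0)) : Tendsto z l (𝓝 0) := by
  rw [tendsto_zero_iff_norm_tendsto_zero]
  have := h.sqrt
  simpa [Real.sqrt_sq (norm_nonneg _)] using this

theorem tendsto_atTop_of_integrableOn {z z' : ℝ → Plane} (hz : ∀ x > 0, HasDerivAt z (z' x) x)
    (hz' : ContinuousOn z' (Ioi 0)) (hz2 : IntegrableOn (fun x => ‖z x‖ ^ 2) (Ioi 0))
    (hz2' : IntegrableOn (fun x => ‖z' x‖ ^ 2) (Ioi 0)) : Tendsto z atTop (𝓝 0) :=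
  tendsto_zero_of_norm_sq (tendsto_zero_of_hasDerivAt_of_integrableOn_Ioi
    (fun x hx => (hz x hx).norm_sq)
    (integrableOn_inner (fun x hx => (hz x hx).continuousAt.continuousWithinAt) hz' hz2 hz2') hz2)

/-- An `H¹` function that is small along a sequence tending to `0` tends to zero there. -/
theorem tendsto_zero_of_frequently {z z' : ℝ → Plane} (hz : ∀ x > 0, HasDerivAt z (z' x) x)
    (hz' : ContinuousOn z' (Ioi 0)) (hz2 : IntegrableOn (fun x => ‖z x‖ ^ 2) (Ioi 0))
    (hz2' : IntegrableOn (fun x => ‖z' x‖ ^ 2) (Ioi 0))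
    (h : ∀ η > 0, ∃ᶠ x in 𝓝[>] 0, ‖z x‖ ^ 2 < η) : Tendsto z (𝓝[>] 0) (𝓝 0) := by
  have hzc : ContinuousOn z (Ioi 0) := fun x hx => (hz x hx).continuousAt.continuousWithinAt
  have hint := integrableOn_inner hzc hz' hz2 hz2'
  set g : ℝ → ℝ := fun x => 2 * inner ℝ (z x) (z' x) with hg
  have hprim : Tendsto (fun x => ∫ s in (0 : ℝ)..x, ‖g s‖) (𝓝[>] 0) (𝓝 0) := by
    have h1 : IntegrableOn (fun s => ‖g s‖) (uIcc 0 1) := by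
      rw [uIcc_of_le zero_le_one, integrableOn_Icc_iff_integrableOn_Ioc]
      exact (hint.mono_set Ioc_subset_Ioi_self).norm
    have h2 := intervalIntegral.continuousOn_primitive_interval h1 0 left_mem_uIcc
    have h3 : Tendsto (fun x => ∫ s in (0 : ℝ)..x, ‖g s‖) (𝓝[uIcc 0 1] 0)
        (𝓝 (∫ s in (0 : ℝ)..0, ‖g s‖)) := h2
    rw [intervalIntegral.integral_same] at h3
    refine h3.mono_left (nhdsWithin_le_of_mem ?_)
    rw [uIcc_of_le zero_le_one]
    exact Icc_mem_nhdsGT one_pos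
  refine tendsto_zero_of_norm_sq (squeeze_zero' (Eventually.of_forall fun x => by positivity) ?_ hprim)
  filter_upwards [self_mem_nhdsWithin] with x hx
  have hx : 0 < x := hx
  refine le_of_forall_pos_le_add fun η hη => ?_
  obtain ⟨t, ht, ht0⟩ := ((h η hη).and_eventually (Ioc_mem_nhdsGT hx)).exists
  have hsub : uIcc t x ⊆ Ioi 0 := by
    rw [uIcc_of_le ht0.2]; exact fun s hs => lt_of_lt_of_le ht0.1 hs.1
  have h1 : ∫ s in t..x, g s = ‖z x‖ ^ 2 - ‖z t‖ ^ 2 :=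
    intervalIntegral.integral_eq_sub_of_hasDerivAt (fun s hs => (hz s (hsub hs)).norm_sq)
      (((continuousOn_const.mul (hzc.inner hz')).mono hsub).intervalIntegrable)
  have h2 : ∫ s in t..x, g s ≤ ∫ s in (0 : ℝ)..x, ‖g s‖ := by
    rw [intervalIntegral.integral_of_le ht0.2, intervalIntegral.integral_of_le hx.le]
    refine (Real.le_norm_self _).trans ((norm_integral_le_integral_norm _).trans ?_)
    exact setIntegral_mono_set (hint.mono_set Ioc_subset_Ioi_self).norm
      (ae_of_all _ fun s => norm_nonneg _) (Ioc_subset_Ioc_left ht0.1.le).eventuallyLE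
  linarith

/-- Square integrable solutions of the forced system belong to `H¹` and vanish at both ends. -/
theorem ClassP.h1_of_forced {μm μp : ℝ} {P : ℝ → Mat} {β : ℝ} {Pstar : Mat}
    (hP : ClassP μm μp P β Pstar) {z f : ℝ → Plane} (hf : ContinuousOn f (Ioi 0))
    (hf2 : MemLp f 2 halfLine) (hz2 : MemLp z 2 halfLine)
    (hz : ∀ x > 0, HasDerivAt z (act (J * P x) (z x) - act J (f x)) x) :
    MemLp (deriv z) 2 halfLine ∧ Tendsto z (𝓝[>] 0) (𝓝 0) ∧ Tendsto z atTop (𝓝 0) := by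
  have hzc : ContinuousOn z (Ioi 0) := fun x hx => (hz x hx).continuousAt.continuousWithinAt
  have hPz : ContinuousOn (fun x => act (P x) (z x)) (Ioi 0) := continuousOn_act hP.continuousOn hzc
  have hJf : ContinuousOn (fun x => act J (f x)) (Ioi 0) :=
    (continuous_act_left J).comp_continuousOn hf
  have hz'c : ContinuousOn (fun x => act (J * P x) (z x) - act J (f x)) (Ioi 0) :=
    (continuousOn_act (continuousOn_const.mul hP.continuousOn) hzc).sub hJf
  have hf2' := (memLp_two_iff_integrableOn hf).1 hf2
  have hz2' := (memLp_two_iff_integrableOn hzc).1 hz2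
  obtain ⟨a, ha, ha1, hw⟩ := hP.integrableOn_weighted hf hf2' hz2' hz
  -- Near 0, ‖P‖ ≤ (‖P*‖ + 1)x^{−β}, so the weighted integrability applies; away from 0, P is
  -- bounded.
  have hPz2 : IntegrableOn (fun x => ‖act (P x) (z x)‖ ^ 2) (Ioi 0) := by
    obtain ⟨c, hc, hc'⟩ := mem_nhdsGT_iff_exists_Ioc_subset.1
      (hP.tendsto_zero.norm.eventually_le_const (lt_add_one ‖Pstar‖))
    set d := min a c with hd
    have hd0 : 0 < d := lt_min ha hc
    obtain ⟨R, hR⟩ := hP.exists_norm_bound hd0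
    rw [← Ioc_union_Ioi_eq_Ioi hd0.le]
    refine IntegrableOn.union ?_ ?_
    · refine Integrable.mono ((hw.mono_set (Ioc_subset_Ioc_right (min_le_left a c))).const_mul
        ((‖Pstar‖ + 1) ^ 2)) (((hPz.norm.pow 2).mono Ioc_subset_Ioi_self).aestronglyMeasurable
          measurableSet_Ioc) ((ae_restrict_iff' measurableSet_Ioc).2 (ae_of_all _ fun x hx => ?_))
      have hxβ := Real.rpow_pos_of_pos hx.1 β
      have h1 : ‖x ^ β • P x‖ ≤ ‖Pstar‖ + 1 := hc' ⟨hx.1, hx.2.trans (min_le_right _ _)⟩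
      rw [norm_smul, Real.norm_eq_abs, abs_of_pos hxβ] at h1
      rw [Real.norm_eq_abs, Real.norm_eq_abs, abs_of_nonneg (by positivity),
        abs_of_nonneg (by positivity), ← mul_pow]
      gcongr
      calc ‖act (P x) (z x)‖ ≤ ‖P x‖ * ‖z x‖ := norm_act_le _ _
        _ = (x ^ β * ‖P x‖) * ((x ^ β)⁻¹ * ‖z x‖) := by field_simp
        _ ≤ _ := by gcongr
    · refine Integrable.mono ((hz2'.mono_set (Ioi_subset_Ioi hd0.le)).const_mul (R ^ 2))
        (((hPz.norm.pow 2).mono (Ioi_subset_Ioi hd0.le)).aestronglyMeasurable measurableSet_Ioi)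
        ((ae_restrict_iff' measurableSet_Ioi).2 (ae_of_all _ fun x hx => ?_))
      rw [Real.norm_eq_abs, Real.norm_eq_abs, abs_of_nonneg (by positivity),
        abs_of_nonneg (by positivity), ← mul_pow]
      gcongr
      exact (norm_act_le _ _).trans (by gcongr; exact hR x (le_of_lt hx))
  have hmem : MemLp (fun x => act (J * P x) (z x) - act J (f x)) 2 halfLine := by
    have h1 : MemLp (fun x => act J (act (P x) (z x))) 2 halfLine :=
      (actL J).comp_memLp' ((memLp_two_iff_integrableOn hPz).2 hPz2)
    have h2 : MemLp (fun x => act J (f x)) 2 halfLine := (actL J).comp_memLp' hf2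
    simp only [act_mul]
    exact h1.sub h2
  have hz'2 := (memLp_two_iff_integrableOn hz'c).1 hmem
  refine ⟨(memLp_congr_ae ?_).2 hmem, tendsto_zero_of_frequently hz hz'c hz2' hz'2 fun η hη => ?_,
    tendsto_atTop_of_integrableOn hz hz'c hz2' hz'2⟩
  · unfold halfLine
    exact (ae_restrict_iff' measurableSet_Ioi).2 (ae_of_all _ fun x hx => (hz x hx).deriv)
  -- Along points tending to 0, x · x^{−2β}‖z‖² is small, and x^{1−2β} ≥ 1 for 0 < x ≤ 1 because β ≥
  -- 1.
  · have hfreq := frequently_mul_lt_of_integrableOn ha hw hη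
    refine (hfreq.and_eventually (Ioc_mem_nhdsGT (zero_lt_one (α := ℝ)))).mono fun x hx => ?_
    have hx0 : 0 < x := hx.2.1
    refine lt_of_le_of_lt ?_ hx.1
    have hxβ := Real.rpow_pos_of_pos hx0 β
    have h1 : x ^ β ≤ x := by
      have := Real.rpow_le_rpow_of_exponent_ge hx0 hx.2.2 hP.one_le_beta
      rwa [Real.rpow_one] at this
    have h2 : x ^ β ≤ 1 := h1.trans hx.2.2
    have h3 : 1 ≤ x * (x ^ β)⁻¹ := by rwa [← div_eq_mul_inv, one_le_div hxβ]
    have h4 : 1 ≤ (x ^ β)⁻¹ := (one_le_inv₀ hxβ).2 h2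
    calc ‖z x‖ ^ 2 = 1 * 1 * ‖z x‖ ^ 2 := by ring
      _ ≤ (x * (x ^ β)⁻¹) * (x ^ β)⁻¹ * ‖z x‖ ^ 2 := by gcongr
      _ = _ := by ring

/-! ### The linear system attached to a point of `Σ'` -/

/-- The coefficient `P(x) - lam - S(x, w(x))` attached to the point `p = (w, lam)`. -/
noncomputable def coef (P : ℝ → Mat) (S : ℝ → Plane → Mat) (p : (ℝ → Plane) × ℝ) (x : ℝ) : Mat :=
  P x - (p.2 • (1 : Mat) + S x (p.1 x))

/-- `z` is a function whose rotation number defines `j` at the point `p`. -/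
def Represents (P : ℝ → Mat) (p : (ℝ → Plane) × ℝ) (z : ℝ → Plane) : Prop :=
  (p.1 ≠ 0 ∧ z = p.1) ∨
    (p.1 = 0 ∧ IsH1 z ∧ z ≠ 0 ∧ ∀ᵐ x ∂halfLine, tau P z x = p.2 • z x)

theorem isJ_iff {P : ℝ → Mat} {p : (ℝ → Plane) × ℝ} {r : ℝ} :
    IsJ P p r ↔ ∃ z, Represents P p z ∧ IsRot z r := by
  constructor
  · rintro (⟨h, hr⟩ | ⟨h, z, h1, h2, h3, hr⟩)
    · exact ⟨p.1, Or.inl ⟨h, rfl⟩, hr⟩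
    · exact ⟨z, Or.inr ⟨h, h1, h2, h3⟩, hr⟩
  · rintro ⟨z, ⟨h, rfl⟩ | ⟨h, h1, h2, h3⟩, hr⟩
    · exact Or.inl ⟨h, hr⟩
    · exact Or.inr ⟨h, z, h1, h2, h3, hr⟩

theorem ClassS.apply_zero {S : ℝ → Plane → Mat} (hS : ClassS S) {x : ℝ} (hx : 0 < x) :
    S x 0 = 0 := by
  obtain ⟨α, η, -, hη, hb⟩ := hS.bound
  ext i k
  have := hb x hx 0 i k
  rw [(hη i k).2, mul_zero] at this
  exact abs_nonpos_iff.1 this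

theorem ClassS.continuousOn_comp {S : ℝ → Plane → Mat} (hS : ClassS S) {w : ℝ → Plane}
    (hw : ContinuousOn w (Ioi 0)) : ContinuousOn (fun x => S x (w x)) (Ioi 0) :=
  hS.continuousOn.comp (f := fun x => (x, w x)) (continuousOn_id.prodMk hw)
    fun _ hx => ⟨hx, mem_univ _⟩

theorem ClassS.tendsto_comp {S : ℝ → Plane → Mat} (hS : ClassS S) {w : ℝ → Plane} {l : Filter ℝ}
    (hl : ∀ᶠ x in l, 0 < x) (hw : Tendsto w l (𝓝 0)) :
    Tendsto (fun x => S x (w x)) l (𝓝 0) := by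
  obtain ⟨A, hA, hlip⟩ := hS.lipschitz (Metric.closedBall 0 1) (isCompact_closedBall _ _)
  refine squeeze_zero_norm' ?_ (by simpa using hw.norm.const_mul A)
  filter_upwards [hl, hw (Metric.closedBall_mem_nhds 0 one_pos)] with x hx hwx
  have := hlip x hx (w x) hwx 0 (by simp)
  simpa [hS.apply_zero hx] using this

/-- Regularity and decay of the square integrable solutions of `τ z = T(x) z`. -/
theorem ClassP.isSol_of_ae {μm μp : ℝ} {P : ℝ → Mat} {β : ℝ} {Pstar : Mat}
    (hP : ClassP μm μp P β Pstar) {T : ℝ → Mat} (hT : ContinuousOn T (Ioi 0)) {z : ℝ → Plane}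
    (hz : LocAC z) (hz2 : MemLp z 2 halfLine) (hτ2 : MemLp (tau P z) 2 halfLine)
    (hτ : ∀ᵐ x ∂halfLine, tau P z x = act (T x) (z x)) :
    IsSol (fun x => P x - T x) z ∧ MemLp (deriv z) 2 halfLine ∧
      Tendsto z (𝓝[>] 0) (𝓝 0) ∧ Tendsto z atTop (𝓝 0) := by
  have hzc := hz.continuousOn
  have hsol : IsSol (fun x => P x - T x) z := by
    intro x hx
    refine hz.hasDerivAt_of_ae (G := fun x => act (J * (P x - T x)) (z x))
      (continuousOn_act (continuousOn_const.mul (hP.continuousOn.sub hT)) hzc) ?_ hx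
    filter_upwards [hτ] with t ht
    have h1 : act J (act J (deriv z t)) = act J (act (T t) (z t) - act (P t) (z t)) := by
      rw [← ht, tau, add_sub_cancel_right]
    rw [act_J_J] at h1
    rw [act_mul, act_sub, ← neg_sub, act_vneg, ← h1, neg_neg]
  have hfc : ContinuousOn (fun x => act (T x) (z x)) (Ioi 0) := continuousOn_act hT hzc
  refine ⟨hsol, hP.h1_of_forced hfc ((memLp_congr_ae hτ).1 hτ2) hz2 fun x hx => ?_⟩
  refine (hsol x hx).congr_deriv ?_
  rw [mul_sub, act_sub, act_mul J (T x)]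

theorem IsSol.isDecaying {M : ℝ → Mat} (hM : ContinuousOn M (Ioi 0)) {z : ℝ → Plane}
    (hz : IsSol M z) (hoff : OnHalfLine z) (h0 : z ≠ 0) (h1 : Tendsto z (𝓝[>] 0) (𝓝 0))
    (h2 : Tendsto z atTop (𝓝 0)) : IsDecaying M z := by
  refine ⟨hz, fun x hx h => h0 (funext fun t => ?_), h1, h2⟩
  rcases le_or_gt t 0 with ht | ht
  · exact hoff t ht
  · exact hz.eq_zero hM hx h ht

section Points

variable {μm μp : ℝ} {P : ℝ → Mat} {β : ℝ} {Pstar : Mat} {S : ℝ → Plane → Mat}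
  {p : (ℝ → Plane) × ℝ}

theorem sig_solution (hP : ClassP μm μp P β Pstar) (hS : ClassS S) (hp : p ∈ Sig μm μp P S) :
    IsSol (coef P S p) p.1 ∧ MemLp (deriv p.1) 2 halfLine ∧
      Tendsto p.1 (𝓝[>] 0) (𝓝 0) ∧ Tendsto p.1 atTop (𝓝 0) := by
  obtain ⟨⟨-, hAC, h2, hτ2⟩, -, -, hτ⟩ := hp
  refine hP.isSol_of_ae (T := fun x => p.2 • (1 : Mat) + S x (p.1 x))
    (continuousOn_const.add (hS.continuousOn_comp hAC.continuousOn)) hAC h2 hτ2 ?_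
  filter_upwards [hτ] with x hx
  rw [hx, act_add, act_smul, act_one]

theorem isH10_of_mem (hP : ClassP μm μp P β Pstar) (hS : ClassS S) (hp : p ∈ Sig' μm μp P S) :
    IsH10 p.1 := by
  rcases hp with hp | hp
  · obtain ⟨-, h1, h2, -⟩ := sig_solution hP hS hp
    exact ⟨⟨hp.1.1, hp.1.2.1, hp.1.2.2.1, h1⟩, h2⟩
  · rw [hp.1]
    exact h10Submodule.zero_mem

theorem exists_derivative_of_mem (hP : ClassP μm μp P β Pstar) (hS : ClassS S)
    (hp : p ∈ Sig' μm μp P S) :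
    ∃ w' : ℝ → Plane, ContinuousOn w' (Ioi 0) ∧ ∀ x > 0, HasDerivAt p.1 (w' x) x := by
  rcases hp with hp | hp
  · have h := (sig_solution hP hS hp).1
    refine ⟨_, continuousOn_act (continuousOn_const.mul (hP.continuousOn.sub
      (continuousOn_const.add (hS.continuousOn_comp h.continuousOn)))) h.continuousOn, h⟩
  · refine ⟨0, continuousOn_const, fun x _ => ?_⟩
    rw [hp.1]
    exact hasDerivAt_const x 0

theorem continuousOn_of_mem (hP : ClassP μm μp P β Pstar) (hS : ClassS S)
    (hp : p ∈ Sig' μm μp P S) : ContinuousOn p.1 (Ioi 0) :=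
  (isH10_of_mem hP hS hp).1.2.1.continuousOn

theorem mem_Ioo_of_mem (hp : p ∈ Sig' μm μp P S) : p.2 ∈ Ioo μm μp := by
  rcases hp with hp | hp
  · exact hp.2.1
  · exact hp.2.1

theorem tendsto_atTop_of_mem (hP : ClassP μm μp P β Pstar) (hS : ClassS S)
    (hp : p ∈ Sig' μm μp P S) : Tendsto p.1 atTop (𝓝 0) := by
  rcases hp with hp | hp
  · exact (sig_solution hP hS hp).2.2.2
  · rw [hp.1]
    exact tendsto_const_nhds

theorem isSymm_pinf_sub (μm μp lam : ℝ) : (Pinf μm μp - lam • (1 : Mat)).IsSymm := by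
  refine Matrix.IsSymm.ext fun i k => ?_
  fin_cases i <;> fin_cases k <;> simp [Pinf]

theorem det_pinf_sub {lam : ℝ} (h : lam ∈ Ioo μm μp) : (Pinf μm μp - lam • (1 : Mat)).det < 0 := by
  rw [Matrix.det_fin_two]
  simp [Pinf]
  exact mul_neg_of_neg_of_pos (by linarith [h.1]) (by linarith [h.2])

/-- Multiplied by x^β, both λ and S(x, w) vanish at 0, so P* is unchanged. At +∞ the term S(x, w)
vanishes because w does, and λ in the gap (μ⁻, μ⁺) makes (μ⁻ − λ)(μ⁺ − λ) negative. -/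
theorem hyperbolic_coef (hP : ClassP μm μp P β Pstar) (hS : ClassS S)
    (hp : p ∈ Sig' μm μp P S) :
    Hyperbolic (coef P S p) β Pstar (Pinf μm μp - p.2 • (1 : Mat)) := by
  have hS0 := hS.tendsto_comp self_mem_nhdsWithin (isH10_of_mem hP hS hp).2
  have hS1 := hS.tendsto_comp (eventually_gt_atTop 0) (tendsto_atTop_of_mem hP hS hp)
  refine ⟨?_, ?_, hP.one_le_beta, hP.symm_star, hP.det_neg, ?_, isSymm_pinf_sub _ _ _,
    det_pinf_sub (mem_Ioo_of_mem hp), ?_⟩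
  · exact hP.continuousOn.sub (continuousOn_const.add
      (hS.continuousOn_comp (continuousOn_of_mem hP hS hp)))
  · exact fun x hx => (hP.symm x hx).sub ((Matrix.isSymm_one.smul _).add (hS.symm x hx _))
  · have hpow : Tendsto (fun x : ℝ => x ^ β) (𝓝[>] 0) (𝓝 0) := by
      have h := (Real.continuousAt_rpow_const 0 β
        (Or.inr (by linarith [hP.one_le_beta]))).tendsto
      rw [Real.zero_rpow (by linarith [hP.one_le_beta])] at h
      exact h.mono_left nhdsWithin_le_nhds
    have h := hP.tendsto_zero.sub (hpow.smul (hS0.const_add (p.2 • (1 : Mat))))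
    simpa only [coef, smul_sub, zero_smul, sub_zero] using h
  · have h := hP.tendsto_atTop.sub (hS1.const_add (p.2 • (1 : Mat)))
    rwa [add_zero] at h

theorem Represents.isDecaying (hP : ClassP μm μp P β Pstar) (hS : ClassS S)
    (hp : p ∈ Sig' μm μp P S) {z : ℝ → Plane} (hz : Represents P p z) :
    IsDecaying (coef P S p) z := by
  have hc := (hyperbolic_coef hP hS hp).continuousOn
  rcases hz with ⟨h0, rfl⟩ | ⟨h0, ⟨hoff, hAC, h2, -⟩, hne, hτ⟩
  · have hp : p ∈ Sig μm μp P S := hp.resolve_right fun h => h0 h.1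
    obtain ⟨h1, -, h2, h3⟩ := sig_solution hP hS hp
    exact h1.isDecaying hc hp.1.1 h0 h2 h3
  · obtain ⟨h1, -, h3, h4⟩ := hP.isSol_of_ae (T := fun x => p.2 • (1 : Mat) + S x (p.1 x))
      (continuousOn_const.add (hS.continuousOn_comp (continuousOn_of_mem hP hS hp))) hAC h2
      ((memLp_congr_ae hτ).2 (h2.const_smul p.2)) (by
        unfold halfLine at hτ ⊢
        filter_upwards [hτ, ae_restrict_mem measurableSet_Ioi] with x hx hx0
        rw [hx, h0, Pi.zero_apply, hS.apply_zero hx0, add_zero, act_smul, act_one])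
    exact h1.isDecaying hc hoff hne h3 h4

theorem exists_represents (hP : ClassP μm μp P β Pstar) (hp : p ∈ Sig' μm μp P S) :
    ∃ z, Represents P p z := by
  rcases hp with hp | ⟨h0, -, z, ⟨hoff, hAC, h2, hτ2⟩, hne, hτ⟩
  · exact ⟨p.1, Or.inl ⟨hp.2.2.1, rfl⟩⟩
  · obtain ⟨-, h1, -⟩ := hP.isSol_of_ae (T := fun _ => p.2 • (1 : Mat)) continuousOn_const hAC h2
      hτ2 (by filter_upwards [hτ] with x hx; rw [hx, act_smul, act_one])
    exact ⟨z, Or.inr ⟨h0, ⟨hoff, hAC, h2, h1⟩, hne, hτ⟩⟩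

/-- Uniqueness is the Wronskian bound with δ = 0: any two representatives are parallel everywhere,
so neither the choice of eigenfunction nor that of the angle matters. -/
theorem existsUnique_isJ (hP : ClassP μm μp P β Pstar) (hS : ClassS S)
    (hp : p ∈ Sig' μm μp P S) : ∃! r, IsJ P p r := by
  have hyp := hyperbolic_coef hP hS hp
  obtain ⟨z, hz⟩ := exists_represents hP hp
  have hdz := hz.isDecaying hP hS hp
  obtain ⟨r, hr⟩ := hdz.exists_isRot hyp
  refine ⟨r, isJ_iff.2 ⟨z, hz, hr⟩, fun r' hr' => ?_⟩
  obtain ⟨w, hw, hr'⟩ := isJ_iff.1 hr'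
  have hdw := hw.isDecaying hP hS hp
  obtain ⟨C, hC, δ₀, hδ₀, h⟩ := hyp.wronskian_le
  have h1 := h 0 hδ₀.le _ (fun x _ => by simp) w z hdw hdz
  rw [mul_zero] at h1
  have h2 := IsRot.abs_sub_le hdw.ne_zero hdz.ne_zero one_pos h1 hr' hr
  exact sub_eq_zero.1 (abs_nonpos_iff.1 h2)

theorem isJ_j (hP : ClassP μm μp P β Pstar) (hS : ClassS S) (hp : p ∈ Sig' μm μp P S) :
    IsJ P p (j P p) :=
  Classical.epsilon_spec (existsUnique_isJ hP hS hp).exists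

/-! ### Continuity of `j` -/

/-- Sobolev embedding with constant 1: as w vanishes at 0, ‖w(x)‖² is the integral of 2⟨w, w'⟩ ≤
‖w‖² + ‖w'‖². -/
theorem H10.norm_fn_le {w : H10} {w' : ℝ → Plane} (hc : ContinuousOn w' (Ioi 0))
    (hw : ∀ x > 0, HasDerivAt w.fn (w' x) x) {x : ℝ} (hx : 0 < x) : ‖w.fn x‖ ≤ ‖w‖ := by
  have hwc := w.locAC.continuousOn
  have h2 := (memLp_two_iff_integrableOn hwc).1 w.memLp
  have hae : deriv w.fn =ᵐ[halfLine] w' := by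
    unfold halfLine
    exact (ae_restrict_iff' measurableSet_Ioi).2 (ae_of_all _ fun x hx => (hw x hx).deriv)
  have h2' := (memLp_two_iff_integrableOn hc).1 ((memLp_congr_ae hae).1 w.memLp_deriv)
  have hnorm : ‖w‖ ^ 2 = ∫ t in Ioi 0, (‖w.fn t‖ ^ 2 + ‖w' t‖ ^ 2) := by
    rw [H10.norm_sq, integral_add h2 h2']
    congr 1
    exact setIntegral_congr_fun measurableSet_Ioi fun t ht => by simp only [(hw t ht).deriv]
  refine (sq_le_sq₀ (norm_nonneg _) (norm_nonneg _)).1 ?_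
  have hlim : Tendsto (fun t => ‖w.fn t‖ ^ 2 + ‖w‖ ^ 2) (𝓝[>] 0) (𝓝 (0 + ‖w‖ ^ 2)) := by
    simpa using (w.isH10.2.norm.pow 2).add_const (‖w‖ ^ 2)
  rw [zero_add] at hlim
  refine ge_of_tendsto hlim ?_
  filter_upwards [Ioc_mem_nhdsGT hx] with t ht
  have hsub : uIcc t x ⊆ Ioi 0 := by
    rw [uIcc_of_le ht.2]; exact fun s hs => lt_of_lt_of_le ht.1 hs.1
  have h1 : ∫ s in t..x, 2 * inner ℝ (w.fn s) (w' s) = ‖w.fn x‖ ^ 2 - ‖w.fn t‖ ^ 2 :=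
    intervalIntegral.integral_eq_sub_of_hasDerivAt (fun s hs => (hw s (hsub hs)).norm_sq)
      (((continuousOn_const.mul (hwc.inner hc)).mono hsub).intervalIntegrable)
  have hIoc : Ioc t x ⊆ Ioi 0 := fun s hs => ht.1.trans hs.1
  have h3 : ∫ s in t..x, 2 * inner ℝ (w.fn s) (w' s) ≤ ‖w‖ ^ 2 := by
    rw [intervalIntegral.integral_of_le ht.2, hnorm]
    calc _ ≤ ∫ s in Ioc t x, (‖w.fn s‖ ^ 2 + ‖w' s‖ ^ 2) := by
          refine setIntegral_mono ((integrableOn_inner hwc hc h2 h2').mono_set hIoc)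
            ((h2.add h2').mono_set hIoc) fun s => ?_
          have := real_inner_le_norm (w.fn s) (w' s)
          change 2 * inner ℝ (w.fn s) (w' s) ≤ ‖w.fn s‖ ^ 2 + ‖w' s‖ ^ 2
          nlinarith [sq_nonneg (‖w.fn s‖ - ‖w' s‖)]
      _ ≤ _ := setIntegral_mono_set (h2.add h2')
          (ae_of_all _ fun s => by change 0 ≤ ‖w.fn s‖ ^ 2 + ‖w' s‖ ^ 2; positivity)
          hIoc.eventuallyLE
  linarith

theorem norm_fn_sub_le (hP : ClassP μm μp P β Pstar) (hS : ClassS S) {q q' : H10 × ℝ}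
    (hq : (q.1.fn, q.2) ∈ Sig' μm μp P S) (hq' : (q'.1.fn, q'.2) ∈ Sig' μm μp P S) {x : ℝ}
    (hx : 0 < x) : ‖q.1.fn x - q'.1.fn x‖ ≤ ‖q.1 - q'.1‖ := by
  obtain ⟨w', hc, hw⟩ := exists_derivative_of_mem hP hS hq
  obtain ⟨v', hc', hv⟩ := exists_derivative_of_mem hP hS hq'
  exact H10.norm_fn_le (w := q.1 - q'.1) (hc.sub hc') (fun t ht => (hw t ht).sub (hv t ht)) hx

/-- The coefficients attached to points of `Σ'` depend on the point continuously, uniformly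
on `(0, +∞)`. -/
theorem exists_coef_sub_le (hP : ClassP μm μp P β Pstar) (hS : ClassS S) {q₀ : H10 × ℝ}
    (hq₀ : (q₀.1.fn, q₀.2) ∈ Sig' μm μp P S) :
    ∃ A > 0, ∀ᶠ q in 𝓝[{q : H10 × ℝ | (q.1.fn, q.2) ∈ Sig' μm μp P S}] q₀, ∀ x > 0,
      ‖coef P S (q.1.fn, q.2) x - coef P S (q₀.1.fn, q₀.2) x‖ ≤ A * ‖q - q₀‖ := by
  obtain ⟨w', hc, hw⟩ := exists_derivative_of_mem hP hS hq₀
  -- By the sup bound, this ball contains all values of every w within H¹ distance 1 of the base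
  -- point, so one Lipschitz constant suffices.
  obtain ⟨A, hA, hlip⟩ := hS.lipschitz (Metric.closedBall 0 (‖q₀.1‖ + 1)) (isCompact_closedBall _ _)
  refine ⟨‖(1 : Mat)‖ + A, by positivity, ?_⟩
  have hball := mem_nhdsWithin_of_mem_nhds (t := {q : H10 × ℝ | (q.1.fn, q.2) ∈ Sig' μm μp P S})
    (Metric.ball_mem_nhds q₀ one_pos)
  filter_upwards [self_mem_nhdsWithin, hball] with q hq hq1 x hx
  rw [mem_ball_iff_norm] at hq1
  have h1 : ‖q.1 - q₀.1‖ ≤ ‖q - q₀‖ := norm_fst_le (q - q₀)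
  have h2 : ‖q.2 - q₀.2‖ ≤ ‖q - q₀‖ := norm_snd_le (q - q₀)
  have h3 := norm_fn_sub_le hP hS hq hq₀ hx
  have h4 : ‖q₀.1.fn x‖ ≤ ‖q₀.1‖ := H10.norm_fn_le hc hw hx
  have h5 : ‖q.1.fn x‖ ≤ ‖q₀.1‖ + 1 := by
    calc _ = ‖(q.1.fn x - q₀.1.fn x) + q₀.1.fn x‖ := by rw [sub_add_cancel]
      _ ≤ _ := norm_add_le _ _
      _ ≤ _ := by linarith
  have h6 := hlip x hx (q.1.fn x) (by simpa using h5) (q₀.1.fn x) (by simp; linarith)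
  have e : coef P S (q.1.fn, q.2) x - coef P S (q₀.1.fn, q₀.2) x =
      -((q.2 - q₀.2) • (1 : Mat) + (S x (q.1.fn x) - S x (q₀.1.fn x))) := by
    simp only [coef, sub_smul]; abel
  rw [e, norm_neg]
  calc _ ≤ ‖(q.2 - q₀.2) • (1 : Mat)‖ + ‖S x (q.1.fn x) - S x (q₀.1.fn x)‖ := norm_add_le _ _
    _ ≤ ‖q - q₀‖ * ‖(1 : Mat)‖ + A * ‖q - q₀‖ := by
      rw [norm_smul]
      gcongr
      exact h6.trans (by gcongr; exact h3.trans h1)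
    _ = _ := by ring

theorem continuousOn_j (hP : ClassP μm μp P β Pstar) (hS : ClassS S) :
    ContinuousOn (fun q : H10 × ℝ => j P (q.1.fn, q.2))
      {q | (q.1.fn, q.2) ∈ Sig' μm μp P S} := by
  intro q₀ hq₀
  obtain ⟨A, hA, hcoef⟩ := exists_coef_sub_le hP hS hq₀
  obtain ⟨C, hC, δ₀, hδ₀, hw⟩ := (hyperbolic_coef hP hS hq₀).wronskian_le
  obtain ⟨z₀, hz₀, hr₀⟩ := isJ_iff.1 (isJ_j hP hS hq₀)
  have hd₀ := hz₀.isDecaying hP hS hq₀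
  have hlim : Tendsto (fun q : H10 × ℝ => ‖q - q₀‖)
      (𝓝[{q | (q.1.fn, q.2) ∈ Sig' μm μp P S}] q₀) (𝓝 0) :=
    (tendsto_iff_norm_sub_tendsto_zero.1 tendsto_id).mono_left nhdsWithin_le_nhds
  have hlim1 : Tendsto (fun q : H10 × ℝ => A * ‖q - q₀‖)
      (𝓝[{q | (q.1.fn, q.2) ∈ Sig' μm μp P S}] q₀) (𝓝 0) := by
    simpa using hlim.const_mul A
  have hlim2 : Tendsto (fun q : H10 × ℝ => C * (A * ‖q - q₀‖))
      (𝓝[{q | (q.1.fn, q.2) ∈ Sig' μm μp P S}] q₀) (𝓝 0) := by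
    simpa using hlim1.const_mul C
  refine tendsto_iff_norm_sub_tendsto_zero.2
    (squeeze_zero' (Eventually.of_forall fun _ => norm_nonneg _) ?_ hlim2)
  filter_upwards [self_mem_nhdsWithin, hcoef, hlim1.eventually_le_const hδ₀,
    hlim2.eventually_lt_const one_pos] with q hq hqc hq1 hq2
  obtain ⟨z, hz, hr⟩ := isJ_iff.1 (isJ_j hP hS hq)
  have hd := hz.isDecaying hP hS hq
  rw [norm_sub_rev]
  exact IsRot.abs_sub_le hd₀.ne_zero hd.ne_zero hq2 (hw _ hq1 _ hqc z₀ z hd₀ hd) hr₀ hr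

/-! ### Continuity of the index -/

/-- J⁻¹ = −J, so the eigenvalue −κ of J⁻¹P* is the eigenvalue κ of JP*. -/
theorem DecayAngleIn.exists_kernel {a b : ℝ} (h : DecayAngleIn Pstar a b) :
    ∃ φ ∈ Ioo a b, act (J * Pstar - rate Pstar • 1) (dir φ) = 0 := by
  obtain ⟨φ, hφ, he⟩ := h
  refine ⟨φ, hφ, ?_⟩
  have hJ : J⁻¹ = -J := by
    refine Matrix.inv_eq_right_inv ?_
    ext i k
    fin_cases i <;> fin_cases k <;> simp [J]
  rw [hJ] at he
  have e0 := congrFun he 0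
  have e1 := congrFun he 1
  simp [Matrix.mulVec, dotProduct, Fin.sum_univ_two] at e0 e1
  rw [act_sub, act_smul, act_one, sub_eq_zero]
  apply plane_ext
  · simp only [act_apply_zero, PiLp.smul_apply, dir_zero, dir_one, smul_eq_mul, rate]
    linarith
  · simp only [act_apply_one, PiLp.smul_apply, dir_zero, dir_one, smul_eq_mul, rate]
    linarith

theorem sin_two_mul_eq_of_sin_sub {θ φ : ℝ} (h : Real.sin (θ - φ) = 0) :
    Real.sin (2 * θ) = Real.sin (2 * φ) := by
  obtain ⟨n, hn⟩ := Real.sin_eq_zero_iff.1 h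
  have : 2 * θ = 2 * φ + n * (2 * Real.pi) := by linarith
  rw [this, Real.sin_add_int_mul_two_pi]

/-- The limit directions of the decaying solutions at both ends, in terms of `sin (2 θ)`. -/
theorem IsJ.sin_two_mul_limits (hP : ClassP μm μp P β Pstar) (hS : ClassS S)
    (hp : p ∈ Sig' μm μp P S) {r : ℝ} (hr : IsJ P p r) {a b : ℝ} (h : DecayAngleIn Pstar a b) :
    ∃ φ ∈ Ioo a b, ∃ θ₀ θ₁ : ℝ, r = (θ₁ - θ₀) / Real.pi ∧
      Real.sin (2 * θ₀) = Real.sin (2 * φ) ∧ Real.sin (2 * θ₁) < 0 := by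
  obtain ⟨φ, hφ, hφ0⟩ := h.exists_kernel
  obtain ⟨z, hz, θ, θ₀, θ₁, hθ, hθ₀, hθ₁, rfl⟩ := isJ_iff.1 hr
  have hyp := hyperbolic_coef hP hS hp
  have hd := hz.isDecaying hP hS hp
  refine ⟨φ, hφ, θ₀, θ₁, rfl, ?_, ?_⟩
  · have h1 := hd.act_limit_zero hyp hθ hθ₀
    rw [act_dir_of_kernel hφ0] at h1
    exact sin_two_mul_eq_of_sin_sub ((smul_eq_zero.1 h1).resolve_right
      (act_dir_ne_zero (det_sub_rate hP.symm_star hP.det_neg).2 hφ0))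
  · have h1 := hd.act_limit_atTop hyp hθ hθ₁
    have hκ := rate_pos hyp.det_atTop
    generalize rate (Pinf μm μp - p.2 • (1 : Mat)) = κ at h1 hκ
    -- The first row reads κ cos θ₁ + (μ⁺ − λ) sin θ₁ = 0 with both coefficients positive, which
    -- forces sin θ₁ cos θ₁ < 0.
    have h2 := congrArg (fun v : Plane => v 0) h1
    simp only [act_apply_zero, dir_zero, dir_one, J_mul_eq] at h2
    simp [Pinf] at h2
    have hb : 0 < μp - p.2 := by linarith [(mem_Ioo_of_mem hp).2]
    have hne : Real.cos θ₁ ≠ 0 := by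
      intro h0
      have h3 := Real.sin_sq_add_cos_sq θ₁
      rw [h0, mul_zero, zero_add] at h2
      rw [(mul_eq_zero.1 h2).resolve_left hb.ne', h0] at h3
      norm_num at h3
    have h4 : (μp - p.2) * (Real.sin θ₁ * Real.cos θ₁) = -(κ * Real.cos θ₁ ^ 2) := by
      linear_combination Real.cos θ₁ * h2
    have h5 : 0 < κ * Real.cos θ₁ ^ 2 := by positivity
    have h6 : Real.sin θ₁ * Real.cos θ₁ < 0 := by
      by_contra hcon
      nlinarith [mul_nonneg hb.le (not_lt.1 hcon)]
    rw [Real.sin_two_mul]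
    linarith

/-- An integer j would make the two limit directions agree mod π, but sin 2θ is positive at 0 and
negative at +∞. -/
theorem j_ne_int (hP : ClassP μm μp P β Pstar) (hS : ClassS S) (hp : p ∈ Sig' μm μp P S)
    (h : DecayAngleIn Pstar 0 (Real.pi / 2)) (k : ℤ) : j P p ≠ k := by
  intro hk
  obtain ⟨φ, hφ, θ₀, θ₁, hr, h0, h1⟩ := (isJ_j hP hS hp).sin_two_mul_limits hP hS hp h
  rw [hk, eq_div_iff Real.pi_ne_zero] at hr
  have e : 2 * θ₁ = 2 * θ₀ + k * (2 * Real.pi) := by linarith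
  rw [e, Real.sin_add_int_mul_two_pi, h0] at h1
  exact absurd (Real.sin_pos_of_pos_of_lt_pi (by linarith [hφ.1]) (by linarith [hφ.2])) h1.not_gt

/-- If j were a half-integer the limit directions would be orthogonal, and sin 2θ would change sign
between the ends; here it is negative at both. -/
theorem j_add_half_ne_int (hP : ClassP μm μp P β Pstar) (hS : ClassS S)
    (hp : p ∈ Sig' μm μp P S) (h : DecayAngleIn Pstar (Real.pi / 2) Real.pi) (k : ℤ) :
    j P p + 1 / 2 ≠ k := by
  intro hk
  obtain ⟨φ, hφ, θ₀, θ₁, hr, h0, h1⟩ := (isJ_j hP hS hp).sin_two_mul_limits hP hS hp h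
  rw [show j P p = k - 1 / 2 by linarith, eq_div_iff Real.pi_ne_zero] at hr
  have e : 2 * θ₁ = 2 * θ₀ - Real.pi + k * (2 * Real.pi) := by linarith
  rw [e, Real.sin_add_int_mul_two_pi, Real.sin_sub_pi, h0] at h1
  have h2 : Real.sin (2 * φ - 2 * Real.pi) < 0 :=
    Real.sin_neg_of_neg_of_neg_pi_lt (by linarith [hφ.2]) (by linarith [hφ.1])
  rw [Real.sin_sub_two_pi] at h2
  linarith

theorem continuousAt_floor_of_ne {x : ℝ} (h : ∀ k : ℤ, x ≠ k) :
    ContinuousAt (Int.floor : ℝ → ℤ) x := by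
  refine (continuousAt_const (y := ⌊x⌋)).congr ?_
  filter_upwards [Ico_mem_nhds (lt_of_le_of_ne (Int.floor_le x) (h _).symm)
    (Int.lt_floor_add_one x)] with y hy
  exact (Int.floor_eq_iff.2 hy).symm

theorem continuousOn_nodalIndex (hP : ClassP μm μp P β Pstar) (hS : ClassS S)
    (h : DecayAngleIn Pstar 0 (Real.pi / 2) ∨ DecayAngleIn Pstar (Real.pi / 2) Real.pi) :
    ContinuousOn (fun q : H10 × ℝ => nodalIndex P Pstar (q.1.fn, q.2))
      {q | (q.1.fn, q.2) ∈ Sig' μm μp P S} := by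
  intro q hq
  have hj := continuousOn_j hP hS q hq
  unfold nodalIndex
  by_cases h1 : DecayAngleIn Pstar 0 (Real.pi / 2)
  · simp only [h1, if_true]
    exact (continuousAt_floor_of_ne (j_ne_int hP hS hq h1)).comp_continuousWithinAt
      (f := fun q : H10 × ℝ => j P (q.1.fn, q.2)) hj
  · simp only [h1, if_false]
    exact (continuousAt_floor_of_ne (j_add_half_ne_int hP hS hq
      (h.resolve_left h1))).comp_continuousWithinAt
        (f := fun q : H10 × ℝ => j P (q.1.fn, q.2) + 1 / 2) (hj.add_const (1 / 2))

end Points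

end DiracBif

theorem proposition4p12 (μm μp : ℝ) (hμ : μm < μp)
    (P : ℝ → DiracBif.Mat) (β : ℝ) (Pstar : DiracBif.Mat)
    (hP : DiracBif.ClassP μm μp P β Pstar)
    (S : ℝ → DiracBif.Plane → DiracBif.Mat) (hS : DiracBif.ClassS S) :
    -- every point of `Σ'` lies in `H¹₀(0, +∞) × ℝ` and has exactly one rotation number
    (∀ p ∈ DiracBif.Sig' μm μp P S,
      (∃ w : DiracBif.H10, w.fn = p.1) ∧ ∃! r : ℝ, DiracBif.IsJ P p r) ∧
    -- `j` is continuous on `Σ'` in the topology of `H¹₀(0, +∞) × ℝ`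
    ContinuousOn (fun q : DiracBif.H10 × ℝ => DiracBif.j P (q.1.fn, q.2))
      {q | (q.1.fn, q.2) ∈ DiracBif.Sig' μm μp P S} ∧
    -- and so is the integer index `i`
    (DiracBif.DecayAngleIn Pstar 0 (Real.pi / 2) ∨
        DiracBif.DecayAngleIn Pstar (Real.pi / 2) Real.pi →
      ContinuousOn (fun q : DiracBif.H10 × ℝ => DiracBif.nodalIndex P Pstar (q.1.fn, q.2))
        {q | (q.1.fn, q.2) ∈ DiracBif.Sig' μm μp P S}) := by
  refine ⟨fun p hp => ⟨⟨⟨p.1, DiracBif.isH10_of_mem hP hS hp⟩, rfl⟩,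
    DiracBif.existsUnique_isJ hP hS hp⟩, DiracBif.continuousOn_j hP hS, fun h =>
      DiracBif.continuousOn_nodalIndex hP hS h⟩
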